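/- **Setting.** Let $d,m\in\{1,2,3,\dots\}$, $\eta>0$, $L_2>0$, and put $l=\lceil\eta\rceil-1$. A function $g:[0,1]^d\to\mathbb R$ belongs to the $(\eta,L_2)$-Hölder class if it is $l$ times differentiable on $[0,1]^d$ and, for every multi-index $s\in\mathbb Z_{\ge0}^d$ with $|s|=s_1+\dots+s_d=l$, $$|\nabla^s g(y_1)-\nabla^s g(y_2)|\le L_2\,\|y_1-y_2\|_1^{\eta-l}\qquad\text{for all }y_1,y_2\in[0,1]^d .$$ Let $c\ge b>0$ and let $K:\mathbb R\to[0,c]$ be a kernel with $b\le K(t)\le c$ for $t\in[-1,1]$ and $K(t)=0$ for $t\notin[-1,1]$. Let $\mathcal G_m=\{u\in[0,1]^d:\ u_i m\in\{1,\dots,m\}\text{ for all }i\}$ and $U(u)=\big[u^s/s!\big]_{s\in\mathbb Z_{\ge0}^d,\,|s|\le l}$, where $s!=s_1!\cdots s_d!$. For a bandwidth $h\in(0,\tfrac12)$ and $x\in[h,1-h]^d$ let $$B(x)=\frac1{(mh)^d}\sum_{y\in\mathcal G_m}U\!\left(\tfrac{y-x}h\right)U\!\left(\tfrac{y-x}h\right)^{T}\prod_{j=1}^dK\!\left(\tfrac{y_j-x_j}h\right),$$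 $$w_y(x)=\frac1{(mh)^d}\Big(\prod_{j=1}^dK\!\left(\tfrac{y_j-x_j}h\right)\Big)B(x)^{-1}U\!\left(\tfrac{y-x}h\right),\qquad \hat\phi(x)=\sum_{y\in\mathcal G_m}g(y)\,[w_y(x)]_{0},$$ where $[\cdot]_0$ is the entry with multi-index $s=0$; $\hat\phi$ is the local polynomial interpolator of order $l$ for $g$. Finally put $$\Lambda(d,l)=\left(\frac{\pi d}{8e^2}\right)^{d\left(\frac{l+d}d\right)^d}\left(\Big(\frac{l+d}d\Big)^d-1\right)^{\left(\frac{l+d}d\right)^d-1}\frac1{(l+d)^{3l\left(\frac{e(l+d)}d\right)^d}} .$$ **Theorem.** Let $\delta\in(0,1)$, let $g$ belong to the $(\eta,L_2)$-Hölder class, and suppose that $l=\lceil\eta\rceil-1\ge d\ge19$ and $$m\ \ge\ \frac{110(2L_2+1)c}{b}\left(\frac{d(3e)^d}{\Lambda(d,l)^2}\right)\left(\frac1\delta\right)^{1/\eta}.$$ Choose the bandwidth $h=\dfrac{4l(3e)^d}{m\Lambda(d,l)}$. Then $h\in(0,\tfrac12)$ and $$h\ \le\ \frac{2b}{55(2L_2+1)c}\cdot\frac{\Lambda(d,l)\,l}{d};$$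 for every $x\in[h,1-h]^d$ the matrix $B(x)$ is invertible, and $\hat\phi(x)$ is the entry with index $s=0$ of the unique minimizer $\phi\in\mathbb R^{\{s:|s|\le l\}}$ of $$\sum_{y\in\mathcal G_m}\Big(g(y)-\phi^{T}U\!\left(\tfrac{y-x}h\right)\Big)^2\prod_{j=1}^dK\!\left(\tfrac{y_j-x_j}h\right);$$ and $$\sup_{x\in[h,1-h]^d}\big|\hat\phi(x)-g(x)\big|\le\delta .$$ -/

import Mathlib

open scoped BigOperators

noncomputable section

namespace LocalPoly

/-- The cube `[a, b]^d`. -/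
def cube (d : ℕ) (a b : ℝ) : Set (Fin d → ℝ) := Set.Icc (fun _ => a) (fun _ => b)

/-- The mixed partial derivative `∇^s g = ∂^{|s|} g / (∂x_1^{s_1} ⋯ ∂x_d^{s_d})` on the unit cube:
the `|s|`-th Fréchet derivative of `g` within `[0,1]^d`, applied to the tuple of coordinate
directions in which the `i`-th direction occurs exactly `s i` times. Only the values of `g` on
`[0,1]^d` matter for its value at a point of `[0,1]^d`. -/
def multiDeriv {d : ℕ} (s : Fin d → ℕ) (g : (Fin d → ℝ) → ℝ) (x : Fin d → ℝ) : ℝ :=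
  iteratedFDerivWithin ℝ (∑ i, s i) g (cube d 0 1) x
    (fun k => Pi.single (finSigmaFinEquiv.symm k).1 (1 : ℝ))

/-- For `η > 0` this is `l = ⌈η⌉ - 1`, the largest integer strictly smaller than `η`. -/
def holderOrder (η : ℝ) : ℕ := ⌈η⌉₊ - 1

/-- The `(η, L)`-Hölder class on `[0,1]^d`: with `l = ⌈η⌉ - 1`, the function is `l` times
differentiable on `[0,1]^d`, and every partial derivative of order exactly `l` is Hölder continuous
with exponent `η - l` and constant `L` with respect to the `ℓ¹` norm. -/
structure IsHolderClass {d : ℕ} (η L : ℝ) (g : (Fin d → ℝ) → ℝ) : Prop where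
  differentiable : ∀ k < holderOrder η,
    DifferentiableOn ℝ (iteratedFDerivWithin ℝ k g (cube d 0 1)) (cube d 0 1)
  holder : ∀ s : Fin d → ℕ, ∑ i, s i = holderOrder η →
    ∀ y₁ ∈ cube d 0 1, ∀ y₂ ∈ cube d 0 1,
      |multiDeriv s g y₁ - multiDeriv s g y₂|
        ≤ L * (∑ i, |y₁ i - y₂ i|) ^ (η - (holderOrder η : ℝ))

/-- A kernel with values in `[b, c]` on `[-1,1]`, extended by zero to `ℝ`. -/
structure IsKernel (b c : ℝ) (K : ℝ → ℝ) : Prop where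
  mem_Icc : ∀ t ∈ Set.Icc (-1 : ℝ) 1, K t ∈ Set.Icc b c
  eq_zero : ∀ t ∉ Set.Icc (-1 : ℝ) 1, K t = 0

/-- The uniform grid `{u ∈ [0,1]^d : u_i m ∈ {1, …, m} for all i}`. -/
def grid (d m : ℕ) : Finset (Fin d → ℝ) :=
  Fintype.piFinset fun _ => (Finset.Icc 1 m).image fun k : ℕ => (k : ℝ) / (m : ℝ)

/-- The multi-indices `s ∈ ℤ₊^d` with `|s| ≤ l` (so that all entries are at most `l`). -/
abbrev MultiIndex (d l : ℕ) : Type := {s : Fin d → Fin (l + 1) // ∑ i, (s i : ℕ) ≤ l}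

/-- The zero multi-index. -/
def MultiIndex.zero (d l : ℕ) : MultiIndex d l := ⟨fun _ => 0, by simp⟩

/-- The vector `U(u)` with entries `u^s / s!`, for `|s| ≤ l`. -/
def monomialVec {d : ℕ} (l : ℕ) (u : Fin d → ℝ) : MultiIndex d l → ℝ :=
  fun s => (∏ i, u i ^ (s.1 i : ℕ)) / (∏ i, ((s.1 i : ℕ).factorial : ℝ))

/-- The rescaled difference `(y - x) / h`. -/
def rescale {d : ℕ} (h : ℝ) (x y : Fin d → ℝ) : Fin d → ℝ := fun j => (y j - x j) / h

/-- The product kernel `∏_j K((y_j - x_j) / h)`. -/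
def kernelProd {d : ℕ} (K : ℝ → ℝ) (h : ℝ) (x y : Fin d → ℝ) : ℝ :=
  ∏ j, K (rescale h x y j)

/-- The objective of the weighted least squares problem defining local polynomial regression
of order `l` at `x`, with bandwidth `h`, on the grid of parameter `m`. -/
def regressionLoss {d : ℕ} (K : ℝ → ℝ) (l m : ℕ) (h : ℝ) (g : (Fin d → ℝ) → ℝ) (x : Fin d → ℝ)
    (φ : MultiIndex d l → ℝ) : ℝ :=
  ∑ y ∈ grid d m, (g y - ∑ s, φ s * monomialVec l (rescale h x y) s) ^ 2 * kernelProd K h x y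

/-- `B(x) = (mh)^{-d} ∑_y U((y-x)/h) U((y-x)/h)ᵀ ∏_j K((y_j - x_j)/h)`. -/
def gramMatrix {d : ℕ} (K : ℝ → ℝ) (l m : ℕ) (h : ℝ) (x : Fin d → ℝ) :
    Matrix (MultiIndex d l) (MultiIndex d l) ℝ :=
  (1 / ((m : ℝ) * h) ^ d) • ∑ y ∈ grid d m, kernelProd K h x y •
    Matrix.vecMulVec (monomialVec l (rescale h x y)) (monomialVec l (rescale h x y))

/-- The vector weights `w_y(x) = (mh)^{-d} (∏_j K((y_j - x_j)/h)) B(x)⁻¹ U((y-x)/h)`. -/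
def vecWeight {d : ℕ} (K : ℝ → ℝ) (l m : ℕ) (h : ℝ) (x y : Fin d → ℝ) : MultiIndex d l → ℝ :=
  (1 / ((m : ℝ) * h) ^ d * kernelProd K h x y) •
    Matrix.mulVec (gramMatrix K l m h x)⁻¹ (monomialVec l (rescale h x y))

/-- The local polynomial interpolator of order `l`: the sum over the grid of `g(y)` times the
entry of `w_y(x)` at the zero multi-index. -/
def interpolator {d : ℕ} (K : ℝ → ℝ) (l m : ℕ) (h : ℝ) (g : (Fin d → ℝ) → ℝ) (x : Fin d → ℝ) : ℝ :=
  ∑ y ∈ grid d m, g y * vecWeight K l m h x y (MultiIndex.zero d l)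

/-- The constant `Λ(d, l)`; all powers with non-integer exponents are real powers. -/
def Lam (d l : ℕ) : ℝ :=
  (Real.pi * (d : ℝ) / (8 * Real.exp 1 ^ 2)) ^ ((d : ℝ) * (((l : ℝ) + d) / d) ^ d)
    * ((((l : ℝ) + d) / d) ^ d - 1) ^ ((((l : ℝ) + d) / d) ^ d - 1)
    * (1 / ((l : ℝ) + d) ^ (3 * (l : ℝ) * (Real.exp 1 * ((l : ℝ) + d) / d) ^ d))

end LocalPoly

end

namespace LocalPoly

/-! The interpolator is the value at the centre of the polynomial `P` that best fits `g` in the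
kernel-weighted least squares sense. It is compared with the Taylor polynomial `T` of `g` at `x`,
whose value at the centre is `g x`. On the window `T` misses `g` by at most `R = L₂ (d h)^η`. By the
normal equations the weighted sum of squares of `P - T` is at most the loss of `T`, hence at most
`R²` times the total weight (`regressionLoss_eq`).

It remains to pass from a weighted mean square to the value at the centre. In one variable, Lagrange
extrapolation from spread-out nodes gives `p(0)² ≤ C · mean(p²)` with `C = 2 (l+1)^(2l+2) c/b`. As
`P - T` has degree at most `l` in each variable, this tensorizes with constant `C^d`, so the squared
error is at most `C^d R²` (`sq_interpolator_sub_le`). No eigenvalue bound for `B(x)` is needed; its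
invertibility holds because a nonzero polynomial of degree at most `l` cannot vanish on a product of
sets with more than `l` points each.

Finally `Λ ≤ (l+d)^(-4l)` is tiny. With `Y = (2/55) Λ l b/c`, the bandwidth satisfies `d h ≤ Y
δ^(1/η) / (2L₂+1)`, so `R ≤ Y^d δ` because `η ≥ l ≥ d`. Since `C Y² ≤ 1`, the error is at most `δ`.
-/

/-! ### Extrapolation to the origin in one variable -/

open Polynomial in
/-- Extrapolation to the origin from separated nodes of the unit interval. -/
theorem sq_eval_zero_le_sum_nodes {l : ℕ} {p : ℝ[X]} (hp : p.natDegree ≤ l) {z : ℕ → ℝ} {ρ : ℝ}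
    (hρ : 0 < ρ) (hz : ∀ i ≤ l, |z i| ≤ 1) (hsep : ∀ i ≤ l, ∀ j ≤ l, i ≠ j → ρ ≤ |z i - z j|) :
    p.eval 0 ^ 2
      ≤ ((l : ℝ) + 1) * (ρ⁻¹ ^ l) ^ 2 * ∑ i ∈ Finset.range (l + 1), p.eval (z i) ^ 2 := by
  classical
  have hinj : Set.InjOn z (Finset.range (l + 1) : Finset ℕ) := by
    intro i hi j hj hij
    by_contra hne
    have := hsep i (by simpa [Nat.lt_succ_iff] using hi) j (by simpa [Nat.lt_succ_iff] using hj) hne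
    rw [hij, sub_self, abs_zero] at this
    linarith
  have hdeg : p.degree < (Finset.range (l + 1)).card := by
    rw [Finset.card_range]
    exact lt_of_le_of_lt degree_le_natDegree (by exact_mod_cast Nat.lt_succ_of_le hp)
  -- At the origin the basis polynomial is a product of `l` factors `|z j| / |z i - z j|`, each at
  -- most `1 / ρ`.
  have hbasis : ∀ i ∈ Finset.range (l + 1),
      |(Lagrange.basis (Finset.range (l + 1)) z i).eval 0| ≤ ρ⁻¹ ^ l := by
    intro i hi
    rw [Lagrange.basis, eval_prod, Finset.abs_prod]
    have hcard : ((Finset.range (l + 1)).erase i).card = l := by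
      rw [Finset.card_erase_of_mem hi, Finset.card_range, Nat.add_sub_cancel]
    calc _ ≤ ∏ _j ∈ (Finset.range (l + 1)).erase i, ρ⁻¹ := by
          refine Finset.prod_le_prod (fun _ _ => abs_nonneg _) fun j hj => ?_
          have hji := Finset.ne_of_mem_erase hj
          have hjl : j ≤ l := Nat.lt_succ_iff.1 (Finset.mem_range.1 (Finset.mem_of_mem_erase hj))
          have hil : i ≤ l := Nat.lt_succ_iff.1 (Finset.mem_range.1 hi)
          simp only [Lagrange.basisDivisor, eval_mul, eval_C, eval_sub, eval_X, abs_mul, abs_inv,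
            zero_sub, abs_neg]
          calc _ ≤ ρ⁻¹ * 1 := by
                gcongr
                · exact hsep i hil j hjl hji.symm
                · exact hz j hjl
            _ = _ := mul_one _
      _ = _ := by rw [Finset.prod_const, hcard]
  have heq : p.eval 0 = ∑ i ∈ Finset.range (l + 1),
      p.eval (z i) * (Lagrange.basis (Finset.range (l + 1)) z i).eval 0 := by
    conv_lhs => rw [Lagrange.eq_interpolate hinj hdeg]
    rw [Lagrange.interpolate_apply, eval_finsetSum]
    simp
  calc p.eval 0 ^ 2 ≤ (Finset.range (l + 1)).card * ∑ i ∈ Finset.range (l + 1),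
        (p.eval (z i) * (Lagrange.basis (Finset.range (l + 1)) z i).eval 0) ^ 2 := by
        rw [heq]; exact sq_sum_le_card_mul_sum_sq
    _ ≤ (Finset.range (l + 1)).card * ∑ i ∈ Finset.range (l + 1),
        (p.eval (z i) ^ 2 * (ρ⁻¹ ^ l) ^ 2) := by
        gcongr with i hi
        rw [mul_pow]
        gcongr ?_ * ?_
        exact sq_le_sq' (neg_le_of_abs_le (hbasis i hi)) (le_of_abs_le (hbasis i hi))
    _ = _ := by rw [← Finset.sum_mul, Finset.card_range]; push_cast; ring

/-- Division with remainder by `M` makes the indices `i * M + t` distinct; the leftover terms are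
nonnegative and are dropped. -/
theorem sum_blocks_le_sum_range {n M q : ℕ} (hn : M * q ≤ n) {f : ℕ → ℝ} (hf : ∀ k, 0 ≤ f k) :
    ∑ t ∈ Finset.range M, ∑ i ∈ Finset.range q, f (i * M + t) ≤ ∑ k ∈ Finset.range n, f k := by
  classical
  rw [← Finset.sum_product']
  have hinj : Set.InjOn (fun a : ℕ × ℕ => a.2 * M + a.1)
      (Finset.range M ×ˢ Finset.range q : Finset (ℕ × ℕ)) := by
    rintro ⟨t, i⟩ h ⟨t', i'⟩ h' heq
    simp only [Finset.coe_product, Finset.coe_range, Set.mem_prod, Set.mem_Iio] at h h' heq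
    have h1 : (i * M + t) / M = i := by
      rw [mul_comm, Nat.mul_add_div (by omega), Nat.div_eq_of_lt h.1, add_zero]
    have h2 : (i' * M + t') / M = i' := by
      rw [mul_comm, Nat.mul_add_div (by omega), Nat.div_eq_of_lt h'.1, add_zero]
    have h3 : i = i' := by rw [← h1, ← h2, heq]
    subst h3
    simpa using heq
  rw [← Finset.sum_image (f := f) hinj]
  refine Finset.sum_le_sum_of_subset_of_nonneg ?_ fun k _ _ => hf k
  intro k hk
  simp only [Finset.mem_image, Finset.mem_product, Finset.mem_range, Prod.exists] at hk ⊢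
  obtain ⟨t, i, ⟨ht, hi⟩, rfl⟩ := hk
  calc i * M + t < (i + 1) * M := by rw [add_mul]; omega
    _ ≤ q * M := Nat.mul_le_mul_right _ hi
    _ ≤ n := by rwa [mul_comm]

open Polynomial in
/-- A polynomial of degree at most `l` is controlled at the origin by its mean square over
sufficiently many equispaced points of `[-1, 1]`. -/
theorem sq_eval_zero_le_sum_range {l n : ℕ} {p : ℝ[X]} (hp : p.natDegree ≤ l) {a s : ℝ}
    (hs : 0 < s) (hn : 1 ≤ ((n : ℝ) / (l + 1) - 1) * (s * (l + 1)))
    (hz : ∀ k < n, |a + k * s| ≤ 1) :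
    n * p.eval 0 ^ 2
      ≤ 2 * ((l : ℝ) + 1) ^ (2 * l + 2) * ∑ k ∈ Finset.range n, p.eval (a + k * s) ^ 2 := by
  -- The points are split into `M` interleaved blocks `t, t + M, …, t + l M`. Each has `l + 1` nodes
  -- at mutual distance at least `s M ≥ 1 / (l + 1)`, and the node inequality is summed over the
  -- blocks.
  set M := n / (l + 1) with hM
  have hMn : M * (l + 1) ≤ n := Nat.div_mul_le_self _ _
  have hl : (0 : ℝ) < l + 1 := by positivity
  have hlt : (n : ℝ) < (M + 1) * (l + 1) := by
    have h := Nat.lt_mul_div_succ n (Nat.succ_pos l)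
    rw [mul_comm] at h
    exact_mod_cast h
  have hsM : 1 ≤ s * M * (l + 1) := by
    have : (n : ℝ) / (l + 1) - 1 ≤ M := by
      rw [sub_le_iff_le_add, div_le_iff₀ hl]; exact hlt.le
    calc (1 : ℝ) ≤ _ := hn
      _ ≤ M * (s * (l + 1)) := by gcongr
      _ = _ := by ring
  have hM1 : (1 : ℝ) ≤ M := by
    have : M ≠ 0 := by
      rintro h0
      rw [h0] at hsM
      norm_num at hsM
    exact_mod_cast Nat.one_le_iff_ne_zero.2 this
  have hblock : ∀ t ∈ Finset.range M, p.eval 0 ^ 2 ≤ ((l : ℝ) + 1) ^ (2 * l + 1) *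
      ∑ i ∈ Finset.range (l + 1), p.eval (a + ((i * M + t : ℕ) : ℝ) * s) ^ 2 := by
    intro t ht
    have h := sq_eval_zero_le_sum_nodes (z := fun i => a + ((i * M + t : ℕ) : ℝ) * s) hp
      (ρ := s * M) (by positivity) ?_ ?_
    · refine h.trans ?_
      have h1 : (s * M)⁻¹ ≤ (l : ℝ) + 1 := by
        rw [inv_le_iff_one_le_mul₀ (by positivity)]; linarith
      calc _ ≤ ((l : ℝ) + 1) * (((l : ℝ) + 1) ^ l) ^ 2 *
            ∑ i ∈ Finset.range (l + 1), p.eval (a + ((i * M + t : ℕ) : ℝ) * s) ^ 2 := by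
            have := Finset.sum_nonneg (s := Finset.range (l + 1)) fun i _ =>
              sq_nonneg (p.eval (a + ((i * M + t : ℕ) : ℝ) * s))
            gcongr
        _ = _ := by ring
    · intro i hi
      refine hz _ ?_
      calc i * M + t < (i + 1) * M := by rw [add_mul]; simp only [Finset.mem_range] at ht; omega
        _ ≤ (l + 1) * M := Nat.mul_le_mul_right _ (by omega)
        _ ≤ n := by rwa [mul_comm]
    · intro i _ j _ hij
      have : a + ((i * M + t : ℕ) : ℝ) * s - (a + ((j * M + t : ℕ) : ℝ) * s)
          = s * M * ((i : ℝ) - j) := by push_cast; ring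
      rw [this, abs_mul, abs_of_nonneg (by positivity : 0 ≤ s * M)]
      have h1 : (1 : ℝ) ≤ |(i : ℝ) - j| := by
        have : (1 : ℤ) ≤ |(i : ℤ) - j| := Int.one_le_abs (by omega)
        exact_mod_cast this
      exact le_mul_of_one_le_right (by positivity) h1
  have hsum := Finset.sum_le_sum hblock
  rw [Finset.sum_const, Finset.card_range, nsmul_eq_mul, ← Finset.mul_sum] at hsum
  have hle := sum_blocks_le_sum_range hMn (f := fun k => p.eval (a + (k : ℝ) * s) ^ 2)
    fun _ => sq_nonneg _
  -- Rounding costs a factor 2: `n < (M + 1) (l + 1) ≤ 2 M (l + 1)`.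
  calc n * p.eval 0 ^ 2 ≤ (2 * (l + 1)) * (M * p.eval 0 ^ 2) := by
        rw [← mul_assoc]
        gcongr
        nlinarith
    _ ≤ (2 * (l + 1)) * (((l : ℝ) + 1) ^ (2 * l + 1) *
          ∑ k ∈ Finset.range n, p.eval (a + k * s) ^ 2) := by
        refine mul_le_mul_of_nonneg_left ?_ (by positivity)
        exact hsum.trans (mul_le_mul_of_nonneg_left hle (by positivity))
    _ = _ := by ring

/-! ### Grid points in a kernel window -/

/-- The one-dimensional grid `{1/m, 2/m, …, 1}`. -/
noncomputable def lineGrid (m : ℕ) : Finset ℝ :=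
  (Finset.Icc 1 m).image fun k : ℕ => (k : ℝ) / (m : ℝ)

theorem sum_lineGrid {m : ℕ} (hm : 0 < m) (f : ℝ → ℝ) :
    ∑ t ∈ lineGrid m, f t = ∑ k ∈ Finset.Icc 1 m, f ((k : ℝ) / m) := by
  rw [lineGrid, Finset.sum_image]
  intro i _ j _ h
  have : (m : ℝ) ≠ 0 := by positivity
  simpa [div_left_inj' this] using h

/-- The grid points at distance at most `h` from `x` are consecutive, and there are at least
`2mh - 1` of them. -/
theorem exists_window {m : ℕ} {x h : ℝ} (hm : 0 < m) (hh : 0 < h) (hx : h ≤ x) (hx' : x ≤ 1 - h) :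
    ∃ u n : ℕ, 2 * (m * h) - 1 ≤ n ∧ ∀ k : ℕ,
      (k ∈ Finset.Icc 1 m ∧ ((k : ℝ) / m - x) / h ∈ Set.Icc (-1 : ℝ) 1)
        ↔ k ∈ Finset.Ico u (u + n) := by
  have hm' : (0 : ℝ) < m := by exact_mod_cast hm
  have hA : 0 ≤ m * (x - h) := mul_nonneg hm'.le (by linarith)
  have hB : 0 ≤ m * (x + h) := mul_nonneg hm'.le (by linarith)
  have hB' : m * (x + h) ≤ m := by nlinarith
  -- The maximum with 1 excludes `k = 0`, which lies in the window when `x = h` but is not a grid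
  -- index.
  set u := max 1 ⌈m * (x - h)⌉₊ with hu
  set v := ⌊m * (x + h)⌋₊ with hv
  have hu1 : (u : ℝ) ≤ m * (x - h) + 1 := by
    rw [hu, Nat.cast_max, Nat.cast_one]
    exact max_le (by linarith) (Nat.ceil_lt_add_one hA).le
  have hv1 : m * (x + h) < v + 1 := Nat.lt_floor_add_one _
  refine ⟨u, v + 1 - u, ?_, fun k => ?_⟩
  · have : (v : ℝ) + 1 ≤ (v + 1 - u : ℕ) + u := by
      exact_mod_cast (show v + 1 ≤ v + 1 - u + u by omega)
    linarith
  · have h1 : ((k : ℝ) / m - x) / h ∈ Set.Icc (-1 : ℝ) 1 ↔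
        m * (x - h) ≤ k ∧ (k : ℝ) ≤ m * (x + h) := by
      rw [Set.mem_Icc, le_div_iff₀ hh, div_le_iff₀ hh, le_sub_iff_add_le, sub_le_iff_le_add,
        le_div_iff₀ hm', div_le_iff₀ hm']
      constructor <;> rintro ⟨h1, h2⟩ <;> constructor <;> linarith
    have hk : (k : ℝ) ≤ m * (x + h) → k ≤ m := fun h2 => by exact_mod_cast h2.trans hB'
    rw [h1, Finset.mem_Icc, Finset.mem_Ico, ← Nat.ceil_le, ← Nat.le_floor_iff hB, ← hv, hu]
    rw [← Nat.le_floor_iff hB, ← hv] at hk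
    omega

-- On its support the kernel lies between `b` and `c`, so the weighted inequality follows from the
-- unweighted one at the cost of `c / b`.
open Polynomial in
theorem sq_eval_zero_mul_sum_kernel_le {l m : ℕ} {b c x h : ℝ} {K : ℝ → ℝ} (hb : 0 < b)
    (hK : IsKernel b c K) (hm : 0 < m) (hh : 0 < h) (hx : h ≤ x) (hx' : x ≤ 1 - h)
    (hmh : (l : ℝ) + 2 ≤ m * h) {p : ℝ[X]} (hp : p.natDegree ≤ l) :
    p.eval 0 ^ 2 * ∑ t ∈ lineGrid m, K ((t - x) / h)
      ≤ (2 * ((l : ℝ) + 1) ^ (2 * l + 2) * (c / b)) *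
        ∑ t ∈ lineGrid m, K ((t - x) / h) * p.eval ((t - x) / h) ^ 2 := by
  classical
  obtain ⟨u, n, hn, hwin⟩ := exists_window hm hh hx hx'
  have hm' : (0 : ℝ) < m := by exact_mod_cast hm
  have hc : 0 ≤ c := by
    have := hK.mem_Icc 0 (by norm_num)
    exact hb.le.trans (this.1.trans this.2)
  have hred : ∀ f : ℝ → ℝ, (∀ t ∉ Set.Icc (-1 : ℝ) 1, f t = 0) →
      ∑ t ∈ lineGrid m, f ((t - x) / h)
        = ∑ k ∈ Finset.range n, f ((u / m - x) / h + k * (1 / (m * h))) := by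
    intro f hf
    rw [sum_lineGrid hm fun t => f ((t - x) / h)]
    have hsub : Finset.Ico u (u + n) ⊆ Finset.Icc 1 m := fun k hk => ((hwin k).2 hk).1
    rw [← Finset.sum_subset hsub, Finset.sum_Ico_eq_sum_range, Nat.add_sub_cancel_left]
    · refine Finset.sum_congr rfl fun k _ => ?_
      congr 1
      push_cast
      field_simp
      ring
    · intro k hk hk'
      refine hf _ fun hmem => hk' ((hwin k).1 ⟨hk, hmem⟩)
  have hin : ∀ k < n, ((u : ℝ) / m - x) / h + k * (1 / (m * h)) ∈ Set.Icc (-1 : ℝ) 1 := by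
    intro k hk
    have := ((hwin (u + k)).2 (by simp [hk])).2
    convert this using 1
    push_cast
    field_simp
    ring
  have h1 := hred K hK.eq_zero
  have h2 := hred (fun t => K t * p.eval t ^ 2) (fun t ht => by simp [hK.eq_zero t ht])
  rw [h1, h2]
  have hmain := sq_eval_zero_le_sum_range (n := n) hp (a := ((u : ℝ) / m - x) / h)
    (s := 1 / (m * h)) (by positivity) ?_ ?_
  · have hlow : ∑ k ∈ Finset.range n, b * p.eval (((u : ℝ) / m - x) / h + k * (1 / (m * h))) ^ 2
        ≤ ∑ k ∈ Finset.range n, K (((u : ℝ) / m - x) / h + k * (1 / (m * h))) *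
          p.eval (((u : ℝ) / m - x) / h + k * (1 / (m * h))) ^ 2 := by
      refine Finset.sum_le_sum fun k hk => ?_
      have := (hK.mem_Icc _ (hin k (Finset.mem_range.1 hk))).1
      gcongr
    have hup : ∑ k ∈ Finset.range n, K (((u : ℝ) / m - x) / h + k * (1 / (m * h))) ≤ n * c := by
      calc _ ≤ ∑ _k ∈ Finset.range n, c :=
            Finset.sum_le_sum fun k hk => (hK.mem_Icc _ (hin k (Finset.mem_range.1 hk))).2
        _ = _ := by simp
    rw [← Finset.mul_sum] at hlow
    calc _ ≤ p.eval 0 ^ 2 * (n * c) := by gcongr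
      _ = c * (n * p.eval 0 ^ 2) := by ring
      _ ≤ c * (2 * ((l : ℝ) + 1) ^ (2 * l + 2) * ∑ k ∈ Finset.range n,
          p.eval (((u : ℝ) / m - x) / h + k * (1 / (m * h))) ^ 2) := by gcongr
      _ = (2 * ((l : ℝ) + 1) ^ (2 * l + 2) * (c / b)) * (b * ∑ k ∈ Finset.range n,
          p.eval (((u : ℝ) / m - x) / h + k * (1 / (m * h))) ^ 2) := by field_simp
      _ ≤ _ := by gcongr
  · have hl : (0 : ℝ) < l + 1 := by positivity
    -- With step `1 / (m h)` and `n ≥ 2 m h - 1`, the spacing condition becomes `n - (l + 1) ≥ m h`,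
    -- which is where `l + 2 ≤ m h` is used.
    have e : ((n : ℝ) / (l + 1) - 1) * (1 / (m * h) * (l + 1)) = (n - (l + 1)) / (m * h) := by
      field_simp
    rw [e, one_le_div (by positivity)]
    linarith
  · exact fun k hk => abs_le.2 (hin k hk)

/-! ### Tensorization -/

theorem sum_piFinset_succ {d : ℕ} (S : Finset ℝ) (f : (Fin (d + 1) → ℝ) → ℝ) :
    ∑ y ∈ Fintype.piFinset (fun _ : Fin (d + 1) => S), f y
      = ∑ t ∈ S, ∑ y ∈ Fintype.piFinset (fun _ : Fin d => S), f (Fin.cons t y) := by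
  classical
  rw [← Finset.sum_product']
  refine Finset.sum_bij' (fun y _ => (y 0, Fin.tail y)) (fun a _ => Fin.cons a.1 a.2) ?_ ?_ ?_ ?_ ?_
  · intro y hy
    simp only [Fintype.mem_piFinset, Finset.mem_product] at hy ⊢
    exact ⟨hy 0, fun i => hy i.succ⟩
  · intro a ha
    simp only [Fintype.mem_piFinset, Finset.mem_product] at ha ⊢
    exact fun i => Fin.cases ha.1 ha.2 i
  · intro y _; exact Fin.cons_self_tail y
  · intro a _; simp
  · intro y _; simp

open Polynomial in
/-- Tensorization of a one-dimensional weighted point evaluation inequality. -/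
theorem sq_apply_mul_prod_sum_le {l d : ℕ} {S : Finset ℝ} {C : ℝ} (hC : 0 ≤ C)
    (w z : Fin d → ℝ → ℝ) (hw : ∀ j, ∀ t ∈ S, 0 ≤ w j t)
    (hQ : ∀ j (p : ℝ[X]), p.natDegree ≤ l →
      p.eval 0 ^ 2 * ∑ t ∈ S, w j t ≤ C * ∑ t ∈ S, w j t * p.eval (z j t) ^ 2)
    (F : (Fin d → ℝ) → ℝ)
    (hF : ∀ j u, ∃ p : ℝ[X], p.natDegree ≤ l ∧ ∀ t, F (Function.update u j t) = p.eval t) :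
    F 0 ^ 2 * ∏ j, ∑ t ∈ S, w j t
      ≤ C ^ d * ∑ y ∈ Fintype.piFinset (fun _ : Fin d => S),
        (∏ j, w j (y j)) * F (fun j => z j (y j)) ^ 2 := by
  induction d with
  | zero =>
    simp only [Finset.univ_eq_empty, Finset.prod_empty, pow_zero, one_mul, mul_one]
    rw [Fintype.piFinset_of_isEmpty, Finset.univ_unique, Finset.sum_singleton]
    exact le_of_eq (congrArg (fun v => F v ^ 2) (Subsingleton.elim _ _))
  | succ d ih =>
    obtain ⟨p, hp, hpF⟩ := hF 0 0
    have hcons : ∀ t, F (Fin.cons t 0) = p.eval t := by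
      intro t
      rw [← hpF t]
      congr 1
      ext i
      refine Fin.cases ?_ (fun i => ?_) i <;> simp
    have h0 : F 0 = p.eval 0 := by
      rw [← hpF 0]
      exact congrArg F (Function.update_eq_self (0 : Fin (d + 1)) (0 : Fin (d + 1) → ℝ)).symm
    have hstep : ∀ t, F (Fin.cons t 0) ^ 2 * ∏ j : Fin d, ∑ s ∈ S, w j.succ s
        ≤ C ^ d * ∑ y ∈ Fintype.piFinset (fun _ : Fin d => S),
          (∏ j : Fin d, w j.succ (y j)) * F (Fin.cons t fun j => z j.succ (y j)) ^ 2 := by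
      intro t
      refine ih (fun j => w j.succ) (fun j => z j.succ) (fun j => hw j.succ) (fun j => hQ j.succ)
        (fun v => F (Fin.cons t v)) fun j u => ?_
      obtain ⟨q, hq, hqF⟩ := hF j.succ (Fin.cons t u)
      exact ⟨q, hq, fun s => by rw [← hqF s, Fin.cons_update]⟩
    have hW : 0 ≤ ∏ j : Fin d, ∑ s ∈ S, w j.succ s :=
      Finset.prod_nonneg fun j _ => Finset.sum_nonneg (hw j.succ)
    rw [Fin.prod_univ_succ, h0, ← mul_assoc, sum_piFinset_succ]
    -- The one-variable inequality moves the first coordinate off the origin while the others stay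
    -- at 0; the induction hypothesis then treats each slice.
    calc _ ≤ (C * ∑ t ∈ S, w 0 t * p.eval (z 0 t) ^ 2) * ∏ j : Fin d, ∑ s ∈ S, w j.succ s := by
          exact mul_le_mul_of_nonneg_right (hQ 0 p hp) hW
      _ = C * ∑ t ∈ S, w 0 t *
            (F (Fin.cons (z 0 t) 0) ^ 2 * ∏ j : Fin d, ∑ s ∈ S, w j.succ s) := by
          simp only [hcons, mul_assoc, Finset.sum_mul]
      _ ≤ C * ∑ t ∈ S, w 0 t * (C ^ d * ∑ y ∈ Fintype.piFinset (fun _ : Fin d => S),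
          (∏ j : Fin d, w j.succ (y j)) * F (Fin.cons (z 0 t) fun j => z j.succ (y j)) ^ 2) := by
          exact mul_le_mul_of_nonneg_left (Finset.sum_le_sum fun t ht =>
            mul_le_mul_of_nonneg_left (hstep _) (hw 0 t ht)) hC
      _ = _ := by
          rw [pow_succ', mul_assoc, Finset.mul_sum (a := C ^ d)]
          congr 1
          refine Finset.sum_congr rfl fun t _ => ?_
          rw [mul_left_comm, Finset.mul_sum]
          congr 1
          refine Finset.sum_congr rfl fun y _ => ?_
          rw [Fin.prod_univ_succ, Fin.cons_zero, mul_assoc]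
          simp only [Fin.cons_succ]
          congr 4
          ext i
          refine Fin.cases ?_ (fun i => ?_) i <;> simp

/-! ### Iterated directional derivatives and their symmetry -/

/-- A family of continuous linear maps on a finite-dimensional space is differentiable if all its
evaluations are. -/
theorem differentiableOn_of_forall_apply {D E F : Type*} [NormedAddCommGroup D] [NormedSpace ℝ D]
    [NormedAddCommGroup E] [NormedSpace ℝ E] [NormedAddCommGroup F] [NormedSpace ℝ F]
    [FiniteDimensional ℝ E] {f : D → E →L[ℝ] F} {s : Set D}
    (h : ∀ y, DifferentiableOn ℝ (fun x => f x y) s) : DifferentiableOn ℝ f s := by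
  have hd : Module.finrank ℝ E = Module.finrank ℝ (Fin (Module.finrank ℝ E) → ℝ) :=
    (Module.finrank_fin_fun ℝ).symm
  let e₁ := ContinuousLinearEquiv.ofFinrankEq hd
  let e₂ := (e₁.arrowCongr (1 : F ≃L[ℝ] F)).trans
    (ContinuousLinearEquiv.piRing (Fin (Module.finrank ℝ E)))
  rw [← Function.id_comp f, ← e₂.symm_comp_self]
  exact e₂.symm.differentiable.comp_differentiableOn (differentiableOn_pi.mpr fun i => h _)

section IteratedDerivative

variable {E : Type*} [NormedAddCommGroup E] [NormedSpace ℝ E]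

/-- The iterated directional derivative within `C` along a list of directions. -/
noncomputable def iterDir (g : E → ℝ) (C : Set E) : List E → E → ℝ
  | [] => g
  | v :: L => fun x => fderivWithin ℝ (iterDir g C L) C x v

/-- Rewriting the multilinear derivative as nested scalar derivatives lets adjacent directions be
exchanged one pair at a time. -/
theorem iteratedFDerivWithin_eq_iterDir {g : E → ℝ} {C : Set E} (hC : UniqueDiffOn ℝ C) {n : ℕ}
    (hg : ∀ k < n, DifferentiableOn ℝ (iteratedFDerivWithin ℝ k g C) C) (v : Fin n → E) {x : E}
    (hx : x ∈ C) : iteratedFDerivWithin ℝ n g C x v = iterDir g C (List.ofFn v) x := by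
  induction n generalizing x with
  | zero => simp [iterDir]
  | succ n ih =>
    rw [List.ofFn_succ, iteratedFDerivWithin_succ_apply_left]
    simp only [iterDir]
    have hEq : Set.EqOn (iterDir g C (List.ofFn fun i => v i.succ))
        (fun y => iteratedFDerivWithin ℝ n g C y (Fin.tail v)) C := fun y hy =>
      (ih (fun k hk => hg k (hk.trans n.lt_succ_self)) (Fin.tail v) hy).symm
    rw [fderivWithin_congr hEq (hEq hx)]
    have hd := (hg n n.lt_succ_self x hx).hasFDerivWithinAt
    have := (((ContinuousMultilinearMap.apply ℝ (fun _ : Fin n => E) ℝ (Fin.tail v)).hasFDerivAt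
      (x := iteratedFDerivWithin ℝ n g C x)).comp_hasFDerivWithinAt x hd).fderivWithin (hC x hx)
    change _ = fderivWithin ℝ ((ContinuousMultilinearMap.apply ℝ (fun _ : Fin n => E) ℝ
      (Fin.tail v)) ∘ iteratedFDerivWithin ℝ n g C) C x (v 0)
    rw [this]
    rfl

/-- Second derivatives are symmetric up to the boundary of a convex set with interior, under mere
twice differentiability: continuity of the second derivative is not required. -/
theorem fderivWithin_fderivWithin_comm {f : E → ℝ} {C : Set E} (hC : Convex ℝ C)
    (hne : (interior C).Nonempty) (hf : DifferentiableOn ℝ f C)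
    (hf' : DifferentiableOn ℝ (fderivWithin ℝ f C) C) {x : E} (hx : x ∈ C) (v w : E) :
    fderivWithin ℝ (fun y => fderivWithin ℝ f C y v) C x w
      = fderivWithin ℝ (fun y => fderivWithin ℝ f C y w) C x v := by
  have hu : UniqueDiffWithinAt ℝ C x := uniqueDiffOn_convex hC hne x hx
  have happ : ∀ u, fderivWithin ℝ (fun y => fderivWithin ℝ f C y u) C x
      = (fderivWithin ℝ (fderivWithin ℝ f C) C x).flip u := by
    intro u
    have h := ((ContinuousLinearMap.apply ℝ ℝ u).hasFDerivAt
      (x := fderivWithin ℝ f C x)).comp_hasFDerivWithinAt x (hf' x hx).hasFDerivWithinAt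
    refine (h.fderivWithin hu).trans ?_
    ext z
    rfl
  rw [happ, happ]
  refine hC.second_derivative_within_at_symmetric hne (f := f) (f' := fderivWithin ℝ f C)
    (fun y hy => ?_) hx ((hf' x hx).hasFDerivWithinAt.mono interior_subset) w v
  exact (hf y (interior_subset hy)).hasFDerivWithinAt.hasFDerivAt (mem_interior_iff_mem_nhds.1 hy)

theorem differentiableOn_iterDir {g : E → ℝ} {C : Set E} (hC : UniqueDiffOn ℝ C) (L : List E)
    (hg : ∀ k ≤ L.length, DifferentiableOn ℝ (iteratedFDerivWithin ℝ k g C) C) :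
    DifferentiableOn ℝ (iterDir g C L) C := by
  have h := (ContinuousMultilinearMap.apply ℝ (fun _ : Fin L.length => E) ℝ
    L.get).differentiable.comp_differentiableOn (hg _ le_rfl)
  refine h.congr fun y hy => ?_
  have := iteratedFDerivWithin_eq_iterDir hC (fun k hk => hg k hk.le) L.get hy
  rw [List.ofFn_get] at this
  exact this.symm

/-- Adjacent swaps generate all permutations. A swap above a list `L` needs derivatives of orders up
to `L.length + 1 < n` to be differentiable, so nothing is asked of the derivative of order `n`
itself. -/
theorem iterDir_eq_of_perm [FiniteDimensional ℝ E] {g : E → ℝ} {C : Set E} (hC : Convex ℝ C)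
    (hne : (interior C).Nonempty) {n : ℕ}
    (hg : ∀ k < n, DifferentiableOn ℝ (iteratedFDerivWithin ℝ k g C) C) {L₁ L₂ : List E}
    (hL : L₁.Perm L₂) (hn : L₁.length ≤ n) {x : E} (hx : x ∈ C) :
    iterDir g C L₁ x = iterDir g C L₂ x := by
  have hu := uniqueDiffOn_convex hC hne
  induction hL generalizing x with
  | nil => rfl
  | cons v _ ih =>
    simp only [List.length_cons] at hn
    have hEq : Set.EqOn (iterDir g C _) (iterDir g C _) C := fun y hy => ih (by omega) hy
    simp only [iterDir]
    rw [fderivWithin_congr hEq (hEq hx)]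
  | trans h₁ _ ih₁ ih₂ => exact (ih₁ hn hx).trans (ih₂ (h₁.length_eq ▸ hn) hx)
  | swap v w L =>
    simp only [List.length_cons] at hn
    have hf' : DifferentiableOn ℝ (fderivWithin ℝ (iterDir g C L) C) C :=
      differentiableOn_of_forall_apply fun u => differentiableOn_iterDir hu (u :: L)
        fun k hk => hg k (by simp only [List.length_cons] at hk; omega)
    exact fderivWithin_fderivWithin_comm hC hne
      (differentiableOn_iterDir hu L fun k hk => hg k (by omega)) hf' hx v w

end IteratedDerivative

theorem convex_cube (d : ℕ) (a b : ℝ) : Convex ℝ (cube d a b) := convex_Icc _ _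

theorem interior_cube_nonempty (d : ℕ) : (interior (cube d 0 1)).Nonempty := by
  rw [cube, ← Set.pi_univ_Icc, interior_pi_set Set.finite_univ]
  exact ⟨fun _ => 1 / 2, fun _ _ => by rw [interior_Icc]; norm_num⟩

theorem mem_cube {d : ℕ} {a b : ℝ} {x : Fin d → ℝ} :
    x ∈ cube d a b ↔ ∀ i, a ≤ x i ∧ x i ≤ b := by
  rw [cube, Set.mem_Icc, Pi.le_def, Pi.le_def, ← forall_and]

/-- A tuple of coordinates is a permutation of the sorted tuple with the same multiplicities. -/
theorem ofFn_perm_sorted {d n : ℕ} {α : Type*} (i : Fin n → Fin d) (f : Fin d → α) :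
    ∃ s : Fin d → ℕ, ∑ j, s j = n ∧
      (List.ofFn fun q => f (i q)).Perm
        (List.ofFn fun k : Fin (∑ j, s j) => f (finSigmaFinEquiv.symm k).1) := by
  classical
  let s : Fin d → ℕ := fun j => Fintype.card {q // i q = j}
  let e : Fin n ≃ Fin (∑ j, s j) := (Equiv.sigmaFiberEquiv i).symm.trans
    ((Equiv.sigmaCongrRight fun j => Fintype.equivFin {q // i q = j}).trans finSigmaFinEquiv)
  refine ⟨s, by simpa using (Fintype.card_congr e).symm, ?_⟩
  have he : (fun q => f (i q)) = (fun k => f (finSigmaFinEquiv.symm k).1) ∘ e := by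
    funext q
    simp [e, Equiv.sigmaFiberEquiv]
  rw [← Multiset.coe_eq_coe, ← Fin.univ_val_map, ← Fin.univ_val_map, he, ← Multiset.map_map]
  congr 1
  exact Multiset.map_univ_val_equiv e

/-- The Hölder condition concerns only sorted tuples of coordinate directions; symmetry extends it
to every tuple. -/
theorem IsHolderClass.abs_iteratedFDerivWithin_sub_le {d : ℕ} {η L : ℝ} {g : (Fin d → ℝ) → ℝ}
    (hg : IsHolderClass η L g) (i : Fin (holderOrder η) → Fin d) {y₁ y₂ : Fin d → ℝ}
    (h₁ : y₁ ∈ cube d 0 1) (h₂ : y₂ ∈ cube d 0 1) :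
    |iteratedFDerivWithin ℝ (holderOrder η) g (cube d 0 1) y₁ (fun q => Pi.single (i q) 1)
      - iteratedFDerivWithin ℝ (holderOrder η) g (cube d 0 1) y₂ (fun q => Pi.single (i q) 1)|
      ≤ L * (∑ j, |y₁ j - y₂ j|) ^ (η - (holderOrder η : ℝ)) := by
  obtain ⟨s, hs, hperm⟩ := ofFn_perm_sorted i fun j => (Pi.single j (1 : ℝ) : Fin d → ℝ)
  have hu := uniqueDiffOn_convex (convex_cube d 0 1) (interior_cube_nonempty d)
  have key : ∀ y ∈ cube d 0 1,
      iteratedFDerivWithin ℝ (holderOrder η) g (cube d 0 1) y (fun q => Pi.single (i q) 1)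
        = multiDeriv s g y := by
    intro y hy
    rw [multiDeriv, iteratedFDerivWithin_eq_iterDir hu hg.differentiable _ hy,
      iteratedFDerivWithin_eq_iterDir hu (hs.symm ▸ hg.differentiable) _ hy]
    exact iterDir_eq_of_perm (convex_cube d 0 1) (interior_cube_nonempty d) hg.differentiable hperm
      (by simp) hy
  rw [key y₁ h₁, key y₂ h₂]
  exact hg.holder s hs y₁ h₁ y₂ h₂

theorem _root_.ContinuousMultilinearMap.apply_const_eq_sum {d n : ℕ}
    (A : ContinuousMultilinearMap ℝ (fun _ : Fin n => Fin d → ℝ) ℝ) (v : Fin d → ℝ) :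
    A (fun _ => v) = ∑ i : Fin n → Fin d, (∏ q, v (i q)) * A (fun q => Pi.single (i q) 1) := by
  conv_lhs => rw [pi_eq_sum_univ' v]
  rw [A.map_sum]
  refine Finset.sum_congr rfl fun i _ => ?_
  rw [A.map_smul_univ, smul_eq_mul]

/-! ### Taylor approximation in the Hölder class -/

/-- Taylor's theorem on the unit interval, with a bound on the oscillation of the last
derivative. -/
theorem abs_sub_taylor_le {l : ℕ} {R : ℝ} (hR : 0 ≤ R) {f : ℕ → ℝ → ℝ}
    (hf : ∀ k < l, ∀ t ∈ Set.Icc (0 : ℝ) 1,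
      HasDerivWithinAt (f k) (f (k + 1) t) (Set.Icc 0 1) t)
    (hl : ∀ t ∈ Set.Icc (0 : ℝ) 1, |f l t - f l 0| ≤ R) {t : ℝ} (ht : t ∈ Set.Icc (0 : ℝ) 1) :
    |f 0 t - ∑ k ∈ Finset.range (l + 1), f k 0 * t ^ k / k.factorial| ≤ R := by
  induction l generalizing f t with
  | zero => simpa using hl t ht
  | succ l ih =>
    -- The Taylor remainder of `f 0` has as derivative the remainder for the shifted family, bounded
    -- by `R`; integrating over a length at most 1 keeps the bound.
    have hrec : ∀ t ∈ Set.Icc (0 : ℝ) 1, _ := fun t ht =>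
      ih (f := fun k => f (k + 1)) (fun k hk => hf (k + 1) (by omega)) hl ht
    have hder : ∀ t ∈ Set.Icc (0 : ℝ) 1, HasDerivWithinAt
        (fun t => f 0 t - ∑ k ∈ Finset.range (l + 2), f k 0 * t ^ k / k.factorial)
        (f 1 t - ∑ k ∈ Finset.range (l + 1), f (k + 1) 0 * t ^ k / k.factorial)
        (Set.Icc 0 1) t := by
      intro t ht
      refine (hf 0 (by omega) t ht).sub ?_
      have hsum : HasDerivAt (fun t : ℝ => ∑ k ∈ Finset.range (l + 2), f k 0 * t ^ k / k.factorial)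
          (∑ k ∈ Finset.range (l + 2), f k 0 * (k * t ^ (k - 1)) / k.factorial) t :=
        HasDerivAt.fun_sum fun k _ => ((hasDerivAt_pow k t).const_mul (f k 0)).div_const _
      refine HasDerivAt.hasDerivWithinAt ?_
      refine hsum.congr_deriv ?_
      rw [Finset.sum_range_succ' _ (l + 1)]
      simp only [Nat.cast_zero, zero_mul, mul_zero, zero_div, add_zero, Nat.add_sub_cancel]
      refine Finset.sum_congr rfl fun k _ => ?_
      rw [Nat.factorial_succ]
      push_cast
      field_simp
    have h := (convex_Icc (0 : ℝ) 1).norm_image_sub_le_of_norm_hasDerivWithin_le hder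
      (fun t ht => hrec t ht) (Set.left_mem_Icc.2 zero_le_one) ht
    have h0 : f 0 0 - ∑ k ∈ Finset.range (l + 2), f k 0 * (0 : ℝ) ^ k / k.factorial = 0 := by
      rw [Finset.sum_range_succ']; simp
    rw [h0, sub_zero, sub_zero, Real.norm_eq_abs, Real.norm_eq_abs, abs_of_nonneg ht.1] at h
    exact h.trans (mul_le_of_le_one_right hR ht.2)

/-- The Taylor polynomial of order `l` at `x`, as a function of the increment. -/
noncomputable def taylorPoly {d : ℕ} (l : ℕ) (g : (Fin d → ℝ) → ℝ) (x v : Fin d → ℝ) : ℝ :=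
  ∑ k ∈ Finset.range (l + 1),
    iteratedFDerivWithin ℝ k g (cube d 0 1) x (fun _ => v) / k.factorial

/-- Along the segment from `x` to `y` the derivative of order `l` oscillates by at most `L N^(η-l) ·
N^l`, with `N` the `ℓ¹` distance. The factor `1 / l!` is given up. -/
theorem IsHolderClass.abs_sub_taylorPoly_le {d : ℕ} {η L : ℝ} {g : (Fin d → ℝ) → ℝ} (hL : 0 ≤ L)
    (hη : (holderOrder η : ℝ) ≤ η) (hg : IsHolderClass η L g) {x y : Fin d → ℝ}
    (hx : x ∈ cube d 0 1) (hy : y ∈ cube d 0 1) :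
    |g y - taylorPoly (holderOrder η) g x (y - x)| ≤ L * (∑ j, |y j - x j|) ^ η := by
  set l := holderOrder η with hl
  set v := y - x with hv
  set N := ∑ j, |y j - x j| with hN
  have hN0 : 0 ≤ N := Finset.sum_nonneg fun j _ => abs_nonneg _
  have hmem : ∀ t ∈ Set.Icc (0 : ℝ) 1, x + t • v ∈ cube d 0 1 := fun t ht =>
    (convex_cube d 0 1).add_smul_sub_mem hx hy ht
  set f : ℕ → ℝ → ℝ := fun k t =>
    iteratedFDerivWithin ℝ k g (cube d 0 1) (x + t • v) (fun _ => v) with hf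
  have hder : ∀ k < l, ∀ t ∈ Set.Icc (0 : ℝ) 1,
      HasDerivWithinAt (f k) (f (k + 1) t) (Set.Icc 0 1) t := by
    intro k hk t ht
    have h1 : HasDerivWithinAt (fun t : ℝ => x + t • v) v (Set.Icc 0 1) t := by
      simpa using (((hasDerivAt_id t).smul_const v).const_add x).hasDerivWithinAt
    have h2 := (hg.differentiable k hk _ (hmem t ht)).hasFDerivWithinAt.comp_hasDerivWithinAt t h1
      hmem
    exact (ContinuousMultilinearMap.apply ℝ (fun _ : Fin k => Fin d → ℝ) ℝ
      (fun _ => v)).hasFDerivAt.comp_hasDerivWithinAt t h2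
  have hosc : ∀ t ∈ Set.Icc (0 : ℝ) 1, |f l t - f l 0| ≤ L * N ^ η := by
    intro t ht
    have hpow : N ^ η = (∑ j, |v j|) ^ l * N ^ (η - l) := by
      have : ∑ j, |v j| = N := rfl
      rw [this, ← Real.rpow_natCast, ← Real.rpow_add_of_nonneg hN0 (Nat.cast_nonneg l)
        (sub_nonneg.2 hη), add_sub_cancel]
    have hsub : f l t - f l 0 = ∑ i : Fin l → Fin d, (∏ q, v (i q)) *
        (iteratedFDerivWithin ℝ l g (cube d 0 1) (x + t • v) (fun q => Pi.single (i q) 1)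
          - iteratedFDerivWithin ℝ l g (cube d 0 1) (x + (0 : ℝ) • v)
            (fun q => Pi.single (i q) 1)) := by
      simp only [hf]
      rw [ContinuousMultilinearMap.apply_const_eq_sum, ContinuousMultilinearMap.apply_const_eq_sum,
        ← Finset.sum_sub_distrib]
      simp only [mul_sub]
    -- Expanding over all tuples of directions, rather than multi-indices, makes the coefficients
    -- sum to exactly the `l`-th power of the `ℓ¹` norm.
    rw [hsub, hpow, Fintype.sum_pow, Finset.sum_mul, Finset.mul_sum]
    refine (Finset.abs_sum_le_sum_abs _ _).trans (Finset.sum_le_sum fun i _ => ?_)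
    rw [abs_mul, Finset.abs_prod, mul_left_comm L]
    refine mul_le_mul_of_nonneg_left ?_ (Finset.prod_nonneg fun _ _ => abs_nonneg _)
    refine (hg.abs_iteratedFDerivWithin_sub_le i (hmem t ht) (hmem 0 (by simp))).trans ?_
    refine mul_le_mul_of_nonneg_left ?_ hL
    refine Real.rpow_le_rpow (Finset.sum_nonneg fun _ _ => abs_nonneg _) ?_ (sub_nonneg.2 hη)
    refine Finset.sum_le_sum fun j _ => ?_
    have : (x + t • v) j - (x + (0 : ℝ) • v) j = t * v j := by simp
    rw [this, abs_mul, abs_of_nonneg ht.1]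
    exact mul_le_of_le_one_left (abs_nonneg _) ht.2
  have h := abs_sub_taylor_le (mul_nonneg hL (Real.rpow_nonneg hN0 η)) hder hosc
    (Set.right_mem_Icc.2 zero_le_one)
  have hsimp : f 0 1 = g y := by simp [hf, hv]
  rw [hsimp] at h
  simpa [hf, taylorPoly] using h

/-! ### Polynomials in the basis `monomialVec` -/

theorem prod_apply_mem_span_monomialVec {d l n : ℕ} (hn : n ≤ l) (i : Fin n → Fin d) :
    (fun u : Fin d → ℝ => ∏ q, u (i q)) ∈
      Submodule.span ℝ
        (Set.range fun (s : MultiIndex d l) (u : Fin d → ℝ) => monomialVec l u s) := by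
  classical
  have hsum : ∑ j, (Finset.univ.filter fun q => i q = j).card = n := by
    rw [← Finset.card_eq_sum_card_fiberwise fun q _ => Finset.mem_univ (i q)]
    simp
  have hlt : ∀ j, (Finset.univ.filter fun q => i q = j).card < l + 1 := fun j =>
    (Finset.card_filter_le _ _).trans_lt (by simp; omega)
  let s : MultiIndex d l := ⟨fun j => ⟨_, hlt j⟩, by simpa [hsum] using hn⟩
  have : (fun u : Fin d → ℝ => ∏ q, u (i q))
      = (∏ j, ((s.1 j : ℕ).factorial : ℝ)) • fun u => monomialVec l u s := by
    funext u
    have hne : (∏ j, ((s.1 j : ℕ).factorial : ℝ)) ≠ 0 :=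
      Finset.prod_ne_zero_iff.2 fun j _ => by positivity
    rw [Pi.smul_apply, smul_eq_mul, monomialVec, mul_div_cancel₀ _ hne]
    rw [← Finset.prod_fiberwise_of_maps_to (g := i) (t := Finset.univ) fun _ _ => Finset.mem_univ _]
    refine Finset.prod_congr rfl fun j _ => ?_
    rw [Finset.prod_congr rfl (g := fun _ => u j), Finset.prod_const]
    intro q hq
    rw [(Finset.mem_filter.1 hq).2]
  rw [this]
  exact Submodule.smul_mem _ _ (Submodule.subset_span ⟨s, rfl⟩)

/-- This makes the Taylor polynomial, in the rescaled variable, a competitor in the regression; the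
powers of `h` go into the coefficients. -/
theorem exists_taylorPoly_eq_sum {d : ℕ} (l : ℕ) (g : (Fin d → ℝ) → ℝ) (x : Fin d → ℝ) (h : ℝ) :
    ∃ τ : MultiIndex d l → ℝ, ∀ u, taylorPoly l g x (h • u) = ∑ s, τ s * monomialVec l u s := by
  have hmem : (fun u => taylorPoly l g x (h • u)) ∈ Submodule.span ℝ
      (Set.range fun (s : MultiIndex d l) (u : Fin d → ℝ) => monomialVec l u s) := by
    have : (fun u => taylorPoly l g x (h • u)) = ∑ k ∈ Finset.range (l + 1),
        ∑ i : Fin k → Fin d, (h ^ k * iteratedFDerivWithin ℝ k g (cube d 0 1) x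
          (fun q => Pi.single (i q) 1) / k.factorial) • fun u : Fin d → ℝ => ∏ q, u (i q) := by
      funext u
      simp only [Finset.sum_apply, Pi.smul_apply, smul_eq_mul, taylorPoly]
      refine Finset.sum_congr rfl fun k _ => ?_
      rw [ContinuousMultilinearMap.apply_const_eq_sum, Finset.sum_div]
      refine Finset.sum_congr rfl fun i _ => ?_
      simp only [Pi.smul_apply, smul_eq_mul, Finset.prod_mul_distrib, Finset.prod_const,
        Finset.card_univ, Fintype.card_fin]
      ring
    rw [this]
    refine Submodule.sum_mem _ fun k hk => Submodule.sum_mem _ fun i _ =>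
      Submodule.smul_mem _ _ (prod_apply_mem_span_monomialVec ?_ i)
    exact Nat.lt_succ_iff.1 (Finset.mem_range.1 hk)
  obtain ⟨τ, hτ⟩ := (Submodule.mem_span_range_iff_exists_fun ℝ).1 hmem
  refine ⟨τ, fun u => ?_⟩
  have := congrFun hτ u
  simpa using this.symm

/-- The polynomial function with coefficient vector `φ` in the basis `monomialVec`. -/
noncomputable def polyFun {d l : ℕ} (φ : MultiIndex d l → ℝ) (u : Fin d → ℝ) : ℝ :=
  ∑ s, φ s * monomialVec l u s

theorem monomialVec_zero {d l : ℕ} (s : MultiIndex d l) :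
    monomialVec l (0 : Fin d → ℝ) s = if s = MultiIndex.zero d l then 1 else 0 := by
  split_ifs with hs
  · subst hs; simp [monomialVec, MultiIndex.zero]
  · have : ∃ i, (s.1 i : ℕ) ≠ 0 := by
      by_contra! hcon
      exact hs (Subtype.ext (funext fun i => Fin.ext (by simpa [MultiIndex.zero] using hcon i)))
    obtain ⟨i, hi⟩ := this
    rw [monomialVec, Finset.prod_eq_zero (Finset.mem_univ i) (by simp [hi]), zero_div]

theorem polyFun_zero {d l : ℕ} (φ : MultiIndex d l → ℝ) :
    polyFun φ 0 = φ (MultiIndex.zero d l) := by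
  simp [polyFun, monomialVec_zero]

open Polynomial in
theorem exists_polynomial_polyFun_update {d l : ℕ} (φ : MultiIndex d l → ℝ) (j : Fin d)
    (u : Fin d → ℝ) :
    ∃ p : ℝ[X], p.natDegree ≤ l ∧ ∀ t, polyFun φ (Function.update u j t) = p.eval t := by
  classical
  refine ⟨∑ s : MultiIndex d l, C (φ s * ((∏ i ∈ Finset.univ.erase j, u i ^ (s.1 i : ℕ)) /
    ∏ i, ((s.1 i : ℕ).factorial : ℝ))) * X ^ (s.1 j : ℕ), ?_, fun t => ?_⟩
  · refine natDegree_sum_le_of_forall_le _ _ fun s _ => ?_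
    exact (natDegree_C_mul_X_pow_le _ _).trans (Nat.lt_succ_iff.1 (s.1 j).2)
  · rw [eval_finsetSum, polyFun]
    refine Finset.sum_congr rfl fun s _ => ?_
    rw [monomialVec, ← Finset.mul_prod_erase _ _ (Finset.mem_univ j), Function.update_self,
      Finset.prod_congr rfl (g := fun i => u i ^ (s.1 i : ℕ))]
    · simp only [eval_mul, eval_C, eval_pow, eval_X]
      ring
    · intro i hi
      rw [Function.update_of_ne (Finset.ne_of_mem_erase hi)]

theorem IsKernel.nonneg {b c : ℝ} {K : ℝ → ℝ} (hb : 0 < b) (hK : IsKernel b c K) (t : ℝ) :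
    0 ≤ K t := by
  by_cases ht : t ∈ Set.Icc (-1 : ℝ) 1
  · exact hb.le.trans (hK.mem_Icc t ht).1
  · exact (hK.eq_zero t ht).ge

theorem kernelProd_nonneg {d : ℕ} {b c : ℝ} {K : ℝ → ℝ} (hb : 0 < b) (hK : IsKernel b c K) (h : ℝ)
    (x y : Fin d → ℝ) : 0 ≤ kernelProd K h x y :=
  Finset.prod_nonneg fun _ _ => hK.nonneg hb _

theorem sum_grid_kernelProd {d m : ℕ} (K : ℝ → ℝ) (h : ℝ) (x : Fin d → ℝ) :
    ∑ y ∈ grid d m, kernelProd K h x y = ∏ j, ∑ t ∈ lineGrid m, K ((t - x j) / h) :=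
  (Finset.prod_univ_sum (fun _ => lineGrid m) fun j t => K ((t - x j) / h)).symm

/-! ### Weighted least squares on the grid -/

section LeastSquares

variable {d l m : ℕ} {b c h : ℝ} {K : ℝ → ℝ} {x : Fin d → ℝ}

theorem sq_coeff_zero_mul_sum_kernelProd_le (hb : 0 < b) (hbc : b ≤ c) (hK : IsKernel b c K)
    (hm : 0 < m) (hh : 0 < h) (hx : x ∈ cube d h (1 - h)) (hmh : (l : ℝ) + 2 ≤ m * h)
    (φ : MultiIndex d l → ℝ) :
    φ (MultiIndex.zero d l) ^ 2 * ∑ y ∈ grid d m, kernelProd K h x y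
      ≤ (2 * ((l : ℝ) + 1) ^ (2 * l + 2) * (c / b)) ^ d *
        ∑ y ∈ grid d m, kernelProd K h x y * polyFun φ (rescale h x y) ^ 2 := by
  have hc : 0 ≤ c := hb.le.trans hbc
  rw [sum_grid_kernelProd, ← polyFun_zero φ]
  exact sq_apply_mul_prod_sum_le (by positivity) (fun j t => K ((t - x j) / h))
    (fun j t => (t - x j) / h) (fun j t _ => hK.nonneg hb _)
    (fun j p hp => sq_eval_zero_mul_sum_kernel_le hb hK hm hh (mem_cube.1 hx j).1
      (mem_cube.1 hx j).2 hmh hp) (polyFun φ) (exists_polynomial_polyFun_update φ)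

theorem sum_grid_kernelProd_pos (hb : 0 < b) (hK : IsKernel b c K)
    (hm : 0 < m) (hh : 0 < h) (hx : x ∈ cube d h (1 - h)) (hmh : (l : ℝ) + 2 ≤ m * h) :
    0 < ∑ y ∈ grid d m, kernelProd K h x y := by
  rw [sum_grid_kernelProd]
  refine Finset.prod_pos fun j _ => ?_
  obtain ⟨u, n, hn, hwin⟩ := exists_window hm hh (mem_cube.1 hx j).1 (mem_cube.1 hx j).2
  have hn0 : (0 : ℝ) < n := by linarith [(Nat.cast_nonneg l : (0 : ℝ) ≤ l)]
  have hu := (hwin u).2 (Finset.mem_Ico.2 ⟨le_rfl, by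
    have : 0 < n := by exact_mod_cast hn0
    omega⟩)
  rw [sum_lineGrid hm fun t => K ((t - x j) / h)]
  exact Finset.sum_pos' (fun _ _ => hK.nonneg hb _)
    ⟨u, hu.1, hb.trans_le (hK.mem_Icc _ hu.2).1⟩

/-- A polynomial of degree at most `l` vanishing at all the grid points in the window is zero. -/
theorem eq_zero_of_sum_kernelProd_eq_zero (hb : 0 < b) (hK : IsKernel b c K) (hm : 0 < m)
    (hh : 0 < h) (hx : x ∈ cube d h (1 - h)) (hmh : (l : ℝ) + 2 ≤ m * h) {φ : MultiIndex d l → ℝ}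
    (hφ : ∑ y ∈ grid d m, kernelProd K h x y * polyFun φ (rescale h x y) ^ 2 = 0) : φ = 0 := by
  classical
  have hm' : (0 : ℝ) < m := by exact_mod_cast hm
  choose u n hn hwin using fun j => exists_window hm hh (mem_cube.1 hx j).1 (mem_cube.1 hx j).2
  let z : Fin d → ℕ → ℝ := fun j k => ((k : ℝ) / m - x j) / h
  let S : Fin d → Finset ℝ := fun j => (Finset.Ico (u j) (u j + n j)).image (z j)
  have hzinj : ∀ j, Function.Injective (z j) := by
    intro j k k' hkk
    have := sub_left_injective ((div_left_inj' hh.ne').1 hkk)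
    exact_mod_cast (div_left_inj' hm'.ne').1 this
  have hcard : ∀ j, l < (S j).card := by
    intro j
    rw [Finset.card_image_of_injective _ (hzinj j), Nat.card_Ico, Nat.add_sub_cancel_left]
    have : (l : ℝ) < n j := by linarith [hn j, (Nat.cast_nonneg l : (0 : ℝ) ≤ l)]
    exact_mod_cast this
  -- Each point of the product of the `S j` is a rescaled grid point of positive weight, so its term
  -- in the vanishing sum is zero.
  have hvanish : ∀ y : Fin d → ℝ, (∀ j, y j ∈ S j) → polyFun φ y = 0 := by
    intro y hy
    choose k hk hky using fun j => Finset.mem_image.1 (hy j)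
    have hg : (fun j => (k j : ℝ) / m) ∈ grid d m := Fintype.mem_piFinset.2 fun j =>
      Finset.mem_image.2 ⟨k j, ((hwin j (k j)).2 (hk j)).1, rfl⟩
    have hr : rescale h x (fun j => (k j : ℝ) / m) = y := funext hky
    have h0 := (Finset.sum_eq_zero_iff_of_nonneg fun y _ =>
      mul_nonneg (kernelProd_nonneg hb hK h x y) (sq_nonneg _)).1 hφ _ hg
    have hpos : 0 < kernelProd K h x (fun j => (k j : ℝ) / m) :=
      Finset.prod_pos fun j _ => hb.trans_le (hK.mem_Icc _ ((hwin j (k j)).2 (hk j)).2).1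
    rw [hr] at h0
    exact pow_eq_zero_iff two_ne_zero |>.1 ((mul_eq_zero.1 h0).resolve_left hpos.ne')
  let e : MultiIndex d l → (Fin d →₀ ℕ) := fun s =>
    Finsupp.equivFunOnFinite.symm fun i => (s.1 i : ℕ)
  have he : Function.Injective e := by
    intro s s' hs
    refine Subtype.ext (funext fun i => Fin.ext ?_)
    exact congrFun (Finsupp.equivFunOnFinite.symm.injective hs) i
  let P : MvPolynomial (Fin d) ℝ := ∑ s : MultiIndex d l,
    MvPolynomial.monomial (e s) (φ s / ∏ i, ((s.1 i : ℕ).factorial : ℝ))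
  have hP : P = 0 := by
    refine MvPolynomial.eq_zero_of_eval_zero_at_prod_finset P S (fun i => ?_) fun y hy => ?_
    · refine lt_of_le_of_lt ?_ (hcard i)
      refine (MvPolynomial.degreeOf_sum_le i _ _).trans (Finset.sup_le fun s _ => ?_)
      refine (MvPolynomial.degreeOf_le_iff).2 fun t ht => ?_
      have := MvPolynomial.support_monomial_subset ht
      rw [Finset.mem_singleton.1 this]
      exact Nat.lt_succ_iff.1 (s.1 i).2
    · rw [← hvanish y hy, polyFun, map_sum]
      refine Finset.sum_congr rfl fun s _ => ?_
      rw [MvPolynomial.eval_monomial, Finsupp.prod_fintype _ _ fun _ => pow_zero _, monomialVec]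
      simp only [e, Finsupp.equivFunOnFinite_symm_apply_apply]
      ring
  funext s
  have hcoef : P.coeff (e s) = φ s / ∏ i, ((s.1 i : ℕ).factorial : ℝ) := by
    simp only [P, MvPolynomial.coeff_sum, MvPolynomial.coeff_monomial, he.eq_iff]
    simp
  rw [hP, MvPolynomial.coeff_zero] at hcoef
  have hne : (∏ j, ((s.1 j : ℕ).factorial : ℝ)) ≠ 0 :=
    Finset.prod_ne_zero_iff.2 fun j _ => by positivity
  simpa [hne] using hcoef.symm

theorem gramMatrix_mulVec (φ : MultiIndex d l → ℝ) :
    (gramMatrix K l m h x).mulVec φ = (1 / ((m : ℝ) * h) ^ d) • ∑ y ∈ grid d m,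
      (kernelProd K h x y * polyFun φ (rescale h x y)) • monomialVec l (rescale h x y) := by
  rw [gramMatrix, Matrix.smul_mulVec, Matrix.sum_mulVec]
  congr 1
  refine Finset.sum_congr rfl fun y _ => ?_
  rw [Matrix.smul_mulVec, Matrix.vecMulVec_mulVec, mul_smul]
  congr 1
  ext s
  simp [polyFun, dotProduct, mul_comm]

/-- The quadratic form of the Gram matrix is, up to a positive factor, the weighted sum of squares
of `polyFun φ`, so a kernel vector vanishes. -/
theorem isUnit_det_gramMatrix (hb : 0 < b) (hK : IsKernel b c K) (hm : 0 < m) (hh : 0 < h)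
    (hx : x ∈ cube d h (1 - h)) (hmh : (l : ℝ) + 2 ≤ m * h) :
    IsUnit (gramMatrix K l m h x).det := by
  rw [isUnit_iff_ne_zero, Ne, ← Matrix.exists_mulVec_eq_zero_iff]
  rintro ⟨φ, hφ, h0⟩
  refine hφ (eq_zero_of_sum_kernelProd_eq_zero hb hK hm hh hx hmh ?_)
  have hm' : (0 : ℝ) < m := by exact_mod_cast hm
  rw [gramMatrix_mulVec] at h0
  have h1 := (smul_eq_zero.1 h0).resolve_left (by positivity)
  have h2 := congrArg (fun v => dotProduct φ v) h1
  simp only [dotProduct_zero, dotProduct_sum, dotProduct_smul, smul_eq_mul] at h2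
  rw [← h2]
  refine Finset.sum_congr rfl fun y _ => ?_
  rw [mul_assoc, sq]
  rfl

/-- The vector-valued local polynomial estimator. -/
noncomputable def regressionCoeff (K : ℝ → ℝ) (l m : ℕ) (h : ℝ) (g : (Fin d → ℝ) → ℝ)
    (x : Fin d → ℝ) : MultiIndex d l → ℝ :=
  ∑ y ∈ grid d m, g y • vecWeight K l m h x y

theorem interpolator_eq_regressionCoeff (g : (Fin d → ℝ) → ℝ) :
    interpolator K l m h g x = regressionCoeff K l m h g x (MultiIndex.zero d l) := by
  simp [interpolator, regressionCoeff]

/-- The normal equations, tested against a polynomial. -/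
theorem sum_residual_mul_polyFun_eq_zero (hm : 0 < m) (hh : 0 < h)
    (hdet : IsUnit (gramMatrix K l m h x).det) (g : (Fin d → ℝ) → ℝ) (ψ : MultiIndex d l → ℝ) :
    ∑ y ∈ grid d m, kernelProd K h x y *
      ((g y - polyFun (regressionCoeff K l m h g x) (rescale h x y)) *
        polyFun ψ (rescale h x y)) = 0 := by
  have hm' : (0 : ℝ) < m := by exact_mod_cast hm
  have hN : (1 / ((m : ℝ) * h) ^ d) ≠ 0 := by positivity
  have h1 := gramMatrix_mulVec (K := K) (m := m) (h := h) (x := x) (regressionCoeff K l m h g x)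
  have h2 : (gramMatrix K l m h x).mulVec (regressionCoeff K l m h g x)
      = (1 / ((m : ℝ) * h) ^ d) • ∑ y ∈ grid d m,
        (kernelProd K h x y * g y) • monomialVec l (rescale h x y) := by
    rw [regressionCoeff, Matrix.mulVec_sum, Finset.smul_sum]
    refine Finset.sum_congr rfl fun y _ => ?_
    rw [Matrix.mulVec_smul, vecWeight, Matrix.mulVec_smul, Matrix.mulVec_mulVec,
      Matrix.mul_nonsing_inv _ hdet, Matrix.one_mulVec, smul_smul, smul_smul]
    congr 1
    ring
  have h3 := smul_right_injective _ hN (h2.symm.trans h1)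
  have h4 := congrArg (fun v => dotProduct ψ v) h3
  simp only [dotProduct_sum, dotProduct_smul, smul_eq_mul] at h4
  rw [← sub_eq_zero, ← Finset.sum_sub_distrib] at h4
  rw [← h4]
  refine Finset.sum_congr rfl fun y _ => ?_
  have : dotProduct ψ (monomialVec l (rescale h x y)) = polyFun ψ (rescale h x y) := rfl
  rw [this]
  ring

/-- Pythagoras: the cross term vanishes by the normal equations. -/
theorem regressionLoss_eq (hm : 0 < m) (hh : 0 < h)
    (hdet : IsUnit (gramMatrix K l m h x).det) (g : (Fin d → ℝ) → ℝ) (φ : MultiIndex d l → ℝ) :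
    regressionLoss K l m h g x φ = regressionLoss K l m h g x (regressionCoeff K l m h g x) +
      ∑ y ∈ grid d m, kernelProd K h x y *
        polyFun (regressionCoeff K l m h g x - φ) (rescale h x y) ^ 2 := by
  have h0 := sum_residual_mul_polyFun_eq_zero hm hh hdet g (regressionCoeff K l m h g x - φ)
  have hloss : ∀ φ, regressionLoss K l m h g x φ
      = ∑ y ∈ grid d m, (g y - polyFun φ (rescale h x y)) ^ 2 * kernelProd K h x y := fun _ => rfl
  have hsub : ∀ y, polyFun (regressionCoeff K l m h g x - φ) y
      = polyFun (regressionCoeff K l m h g x) y - polyFun φ y := fun y => by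
    simp [polyFun, sub_mul]
  refine Eq.trans ?_ (add_zero _)
  rw [hloss, hloss, ← mul_zero (2 : ℝ), ← h0, Finset.mul_sum, ← Finset.sum_add_distrib,
    ← Finset.sum_add_distrib]
  refine Finset.sum_congr rfl fun y _ => ?_
  rw [hsub]
  ring

theorem regressionLoss_lt (hb : 0 < b) (hK : IsKernel b c K) (hm : 0 < m) (hh : 0 < h)
    (hx : x ∈ cube d h (1 - h)) (hmh : (l : ℝ) + 2 ≤ m * h) (g : (Fin d → ℝ) → ℝ)
    {φ : MultiIndex d l → ℝ} (hφ : φ ≠ regressionCoeff K l m h g x) :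
    regressionLoss K l m h g x (regressionCoeff K l m h g x) < regressionLoss K l m h g x φ := by
  rw [regressionLoss_eq hm hh (isUnit_det_gramMatrix hb hK hm hh hx hmh) g φ]
  refine lt_add_of_pos_right _ (lt_of_le_of_ne (Finset.sum_nonneg fun y _ =>
    mul_nonneg (kernelProd_nonneg hb hK h x y) (sq_nonneg _)) fun h0 => hφ ?_)
  exact (sub_eq_zero.1 (eq_zero_of_sum_kernelProd_eq_zero hb hK hm hh hx hmh h0.symm)).symm

/-- If `g` is within `R` of the polynomial with coefficients `τ` at all the grid points of the
window, then the interpolator at the centre is close to the constant coefficient of `τ`. -/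
theorem sq_interpolator_sub_le (hb : 0 < b) (hbc : b ≤ c) (hK : IsKernel b c K) (hm : 0 < m)
    (hh : 0 < h) (hx : x ∈ cube d h (1 - h)) (hmh : (l : ℝ) + 2 ≤ m * h) (g : (Fin d → ℝ) → ℝ)
    (τ : MultiIndex d l → ℝ) {R : ℝ}
    (hR : ∀ y ∈ grid d m, (∀ j, |y j - x j| ≤ h) → |g y - polyFun τ (rescale h x y)| ≤ R) :
    (interpolator K l m h g x - τ (MultiIndex.zero d l)) ^ 2
      ≤ (2 * ((l : ℝ) + 1) ^ (2 * l + 2) * (c / b)) ^ d * R ^ 2 := by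
  have hc : 0 ≤ c := hb.le.trans hbc
  have hpos := sum_grid_kernelProd_pos hb hK hm hh hx hmh
  have h1 := sq_coeff_zero_mul_sum_kernelProd_le hb hbc hK hm hh hx hmh
    (regressionCoeff K l m h g x - τ)
  have h2 := regressionLoss_eq hm hh (isUnit_det_gramMatrix hb hK hm hh hx hmh) g τ
  have h3 : 0 ≤ regressionLoss K l m h g x (regressionCoeff K l m h g x) :=
    Finset.sum_nonneg fun y _ => mul_nonneg (sq_nonneg _) (kernelProd_nonneg hb hK h x y)
  have h4 : regressionLoss K l m h g x τ ≤ R ^ 2 * ∑ y ∈ grid d m, kernelProd K h x y := by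
    rw [Finset.mul_sum]
    refine Finset.sum_le_sum fun y hy => ?_
    by_cases hin : ∀ j, |y j - x j| ≤ h
    · have := hR y hy hin
      refine mul_le_mul_of_nonneg_right ?_ (kernelProd_nonneg hb hK h x y)
      exact sq_le_sq' (neg_le_of_abs_le this) (le_of_abs_le this)
    · push Not at hin
      obtain ⟨j, hj⟩ := hin
      have : kernelProd K h x y = 0 := by
        refine Finset.prod_eq_zero (Finset.mem_univ j) (hK.eq_zero _ fun hmem => ?_)
        have := abs_le.2 hmem
        rw [rescale, abs_div, abs_of_pos hh, div_le_one hh] at this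
        exact absurd this (not_le.2 hj)
      simp [this]
  rw [interpolator_eq_regressionCoeff]
  -- The total weight cancels from both sides, so the bound does not depend on the number of grid
  -- points.
  refine le_of_mul_le_mul_right (h1.trans ?_) hpos
  rw [mul_assoc _ (R ^ 2)]
  refine mul_le_mul_of_nonneg_left ?_ ?_
  · linarith
  · positivity

end LeastSquares

/-! ### Size of `Λ` and of the bandwidth -/

theorem Lam_pos {d l : ℕ} (hd : 1 ≤ d) (hdl : d ≤ l) : 0 < Lam d l := by
  have hd' : (0 : ℝ) < d := by exact_mod_cast hd
  have hl' : (0 : ℝ) < l := by exact_mod_cast hd.trans hdl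
  have hp : 1 < (((l : ℝ) + d) / d) := by rw [one_lt_div hd']; linarith
  have hA : 1 < (((l : ℝ) + d) / d) ^ d := one_lt_pow₀ hp (by omega)
  have h1 : 0 < (((l : ℝ) + d) / d) ^ d - 1 := by linarith
  have := Real.pi_pos
  have := Real.exp_pos 1
  unfold Lam
  positivity

/-- With `N = l + d` and `A = (N/d)^d ≥ 2`, the first two factors of `Λ` are each at most `N^(dA)`
and the last at most `N^(-6lA)`, as `e^d ≥ 2`. Since `d ≤ l`, the total exponent is at most `-4lA ≤
-4l`. -/
theorem Lam_le {d l : ℕ} (hd : 1 ≤ d) (hdl : d ≤ l) : Lam d l ≤ ((l : ℝ) + d) ^ (-(4 * l : ℝ)) := by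
  have hd' : (1 : ℝ) ≤ d := by exact_mod_cast hd
  have hdl' : (d : ℝ) ≤ l := by exact_mod_cast hdl
  have hd0 : (0 : ℝ) < d := by linarith
  have hp : 2 ≤ (((l : ℝ) + d) / d) := by rw [le_div_iff₀ hd0]; linarith
  have hpd : (((l : ℝ) + d) / d) ≤ (l : ℝ) + d := div_le_self (by linarith) hd'
  set N : ℝ := (l : ℝ) + d with hN
  have hN1 : 1 ≤ N := by linarith
  have hN0 : 0 < N := by linarith
  set A : ℝ := (N / d) ^ d with hA
  have hA2 : 2 ≤ A := hp.trans (le_self_pow₀ (by linarith) (by omega))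
  have hAN : A ≤ N ^ (d : ℝ) := by
    rw [Real.rpow_natCast]; exact pow_le_pow_left₀ (by linarith) hpd d
  have hpi := Real.pi_pos
  have he := Real.exp_pos 1
  have he2 : 2 ≤ Real.exp 1 := by linarith [Real.add_one_le_exp (1 : ℝ)]
  have hα : Real.pi * (d : ℝ) / (8 * Real.exp 1 ^ 2) ≤ N := by
    rw [div_le_iff₀ (by positivity)]
    have h4 : (4 : ℝ) ≤ 8 * Real.exp 1 ^ 2 := by nlinarith
    calc Real.pi * d ≤ 4 * N := by
          have := Real.pi_le_four
          have : (d : ℝ) ≤ N := by linarith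
          gcongr
      _ ≤ _ := by rw [mul_comm]; gcongr
  have h1 : (Real.pi * (d : ℝ) / (8 * Real.exp 1 ^ 2)) ^ ((d : ℝ) * A) ≤ N ^ ((d : ℝ) * A) :=
    Real.rpow_le_rpow (by positivity) hα (by positivity)
  have h2 : (A - 1) ^ (A - 1) ≤ N ^ ((d : ℝ) * A) := by
    calc (A - 1) ^ (A - 1) ≤ (A - 1) ^ A :=
          Real.rpow_le_rpow_of_exponent_le (by linarith) (by linarith)
      _ ≤ A ^ A := Real.rpow_le_rpow (by linarith) (by linarith) (by linarith)
      _ ≤ (N ^ (d : ℝ)) ^ A := Real.rpow_le_rpow (by linarith) hAN (by linarith)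
      _ = _ := (Real.rpow_mul hN0.le _ _).symm
  have h3 : (1 : ℝ) / N ^ (3 * (l : ℝ) * (Real.exp 1 * N / d) ^ d) ≤ N ^ (-(6 * l * A)) := by
    rw [one_div, ← Real.rpow_neg hN0.le]
    refine Real.rpow_le_rpow_of_exponent_le hN1 (neg_le_neg ?_)
    have : 2 * A ≤ (Real.exp 1 * N / d) ^ d := by
      rw [mul_div_assoc, mul_pow]
      gcongr
      exact he2.trans (le_self_pow₀ (by linarith) (by omega))
    calc 6 * l * A = 3 * l * (2 * A) := by ring
      _ ≤ _ := by gcongr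
  have hpos2 : 0 ≤ (A - 1) ^ (A - 1) := Real.rpow_nonneg (by linarith) _
  calc Lam d l ≤ N ^ ((d : ℝ) * A) * N ^ ((d : ℝ) * A) * N ^ (-(6 * l * A)) := by
        unfold Lam
        gcongr
    _ = N ^ ((d : ℝ) * A + d * A + -(6 * l * A)) := by
        rw [Real.rpow_add hN0, Real.rpow_add hN0]
    _ ≤ _ := by
        refine Real.rpow_le_rpow_of_exponent_le hN1 ?_
        nlinarith [mul_le_mul_of_nonneg_right hdl' (by linarith : 0 ≤ A)]

theorem Lam_mul_pow_le_one {d l : ℕ} (hd : 1 ≤ d) (hdl : d ≤ l) :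
    Lam d l * ((l : ℝ) + 1) ^ (4 * l) ≤ 1 := by
  have hd' : (1 : ℝ) ≤ d := by exact_mod_cast hd
  have hl' : (0 : ℝ) ≤ l := Nat.cast_nonneg l
  have hN : (0 : ℝ) < (l : ℝ) + d := by linarith
  have h := Lam_le hd hdl
  rw [Real.rpow_neg hN.le, le_inv_comm₀ (Lam_pos hd hdl) (Real.rpow_pos_of_pos hN _)] at h
  have h2 : ((l : ℝ) + d) ^ (4 * l : ℝ) = ((l : ℝ) + d) ^ (4 * l) := by
    rw [← Real.rpow_natCast]; push_cast; rfl
  rw [h2] at h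
  calc _ ≤ Lam d l * ((l : ℝ) + d) ^ (4 * l) := by
        have := (Lam_pos hd hdl).le
        gcongr
    _ ≤ Lam d l * (Lam d l)⁻¹ := mul_le_mul_of_nonneg_left h (Lam_pos hd hdl).le
    _ = 1 := mul_inv_cancel₀ (Lam_pos hd hdl).ne'

theorem Lam_mul_le_one {d l : ℕ} (hd : 1 ≤ d) (hdl : d ≤ l) : Lam d l * l ≤ 1 := by
  refine le_trans ?_ (Lam_mul_pow_le_one hd hdl)
  refine mul_le_mul_of_nonneg_left ?_ (Lam_pos hd hdl).le
  have : ((l : ℝ) + 1) ≤ ((l : ℝ) + 1) ^ (4 * l) :=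
    le_self_pow₀ (by linarith [(Nat.cast_nonneg l : (0 : ℝ) ≤ l)]) (by omega)
  linarith

/-- The constant of the least squares bound, compensated by the size of the bandwidth. -/
theorem leastSquares_const_mul_sq_le_one {d l : ℕ} {b c : ℝ} (hb : 0 < b) (hbc : b ≤ c)
    (hd : 1 ≤ d) (hdl : d ≤ l) :
    (2 * ((l : ℝ) + 1) ^ (2 * l + 2) * (c / b)) * (2 / 55 * (Lam d l * l) * (b / c)) ^ 2 ≤ 1 := by
  have hc : 0 < c := hb.trans_le hbc
  have hl' : (0 : ℝ) ≤ l := Nat.cast_nonneg l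
  have hl1 : 1 ≤ l := hd.trans hdl
  have hΛ := Lam_pos hd hdl
  have hΛ1 := Lam_mul_pow_le_one hd hdl
  have hbc1 : b / c ≤ 1 := (div_le_one hc).2 hbc
  have hone : (1 : ℝ) ≤ l + 1 := by linarith
  calc _ = 8 / 3025 * (b / c) * ((l : ℝ) ^ 2 * ((l : ℝ) + 1) ^ (2 * l + 2) * Lam d l ^ 2) := by
        field_simp; ring
    _ ≤ 1 * 1 * ((((l : ℝ) + 1) ^ (4 * l)) ^ 2 * Lam d l ^ 2) := by
        gcongr
        · norm_num
        · calc (l : ℝ) ^ 2 * ((l : ℝ) + 1) ^ (2 * l + 2)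
              ≤ ((l : ℝ) + 1) ^ 2 * ((l : ℝ) + 1) ^ (2 * l + 2) := by gcongr; linarith
            _ = ((l : ℝ) + 1) ^ (2 * l + 4) := by rw [← pow_add]; congr 1; omega
            _ ≤ ((l : ℝ) + 1) ^ (4 * l * 2) := pow_le_pow_right₀ hone (by omega)
            _ = _ := pow_mul _ _ _
    _ = (Lam d l * ((l : ℝ) + 1) ^ (4 * l)) ^ 2 := by ring
    _ ≤ 1 := pow_le_one₀ (by positivity) hΛ1

/-- The size of the bandwidth. -/
theorem bandwidth_le {d l m : ℕ} {η L₂ b c δ h : ℝ} (hδ : 0 < δ) (hL₂ : 0 < L₂) (hb : 0 < b)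
    (hc : 0 < c) (hd : 1 ≤ d) (hdl : d ≤ l)
    (hm : 110 * (2 * L₂ + 1) * c / b * ((d : ℝ) * (3 * Real.exp 1) ^ d / Lam d l ^ 2)
        * (1 / δ) ^ (1 / η) ≤ (m : ℝ))
    (hh : h = 4 * (l : ℝ) * (3 * Real.exp 1) ^ d / ((m : ℝ) * Lam d l)) :
    h ≤ 2 * b / (55 * (2 * L₂ + 1) * c) * (Lam d l * (l : ℝ) / (d : ℝ)) * δ ^ (1 / η) := by
  have hΛ := Lam_pos hd hdl
  have hd' : (0 : ℝ) < d := by exact_mod_cast hd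
  have he := Real.exp_pos 1
  have hδη : 0 < δ ^ (1 / η) := Real.rpow_pos_of_pos hδ _
  rw [Real.div_rpow zero_le_one hδ.le, Real.one_rpow] at hm
  set E := (3 * Real.exp 1) ^ d with hE
  have hE0 : 0 < E := by positivity
  have hM : 0 < 110 * (2 * L₂ + 1) * c / b * ((d : ℝ) * E / Lam d l ^ 2) * (1 / δ ^ (1 / η)) := by
    positivity
  -- The bandwidth decreases in `m`, so the least admissible `m` is inserted; `4 / 110 = 2 / 55`,
  -- and `Λ²` against `Λ` leaves one factor `Λ`.
  calc h ≤ 4 * (l : ℝ) * E / ((110 * (2 * L₂ + 1) * c / b * ((d : ℝ) * E / Lam d l ^ 2)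
        * (1 / δ ^ (1 / η))) * Lam d l) := by
        rw [hh]
        gcongr
    _ = _ := by field_simp; ring

end LocalPoly

/-! ### The main theorem -/

theorem theorem1 (d l m : ℕ) (η L₂ b c δ h : ℝ) (K : ℝ → ℝ) (g : (Fin d → ℝ) → ℝ)
    (hδ : δ ∈ Set.Ioo (0 : ℝ) 1) (hη : 0 < η) (hL₂ : 0 < L₂)
    (hb : 0 < b) (hbc : b ≤ c) (hK : LocalPoly.IsKernel b c K)
    (hg : LocalPoly.IsHolderClass η L₂ g)
    (hl : (l : ℤ) = ⌈η⌉ - 1) (hdl : d ≤ l) (hd : 19 ≤ d)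
    (hm : 110 * (2 * L₂ + 1) * c / b
        * ((d : ℝ) * (3 * Real.exp 1) ^ d / LocalPoly.Lam d l ^ 2)
        * (1 / δ) ^ (1 / η) ≤ (m : ℝ))
    (hh : h = 4 * (l : ℝ) * (3 * Real.exp 1) ^ d / ((m : ℝ) * LocalPoly.Lam d l)) :
    h ∈ Set.Ioo (0 : ℝ) (1 / 2) ∧
    h ≤ 2 * b / (55 * (2 * L₂ + 1) * c) * (LocalPoly.Lam d l * (l : ℝ) / (d : ℝ)) ∧
    ∀ x ∈ LocalPoly.cube d h (1 - h),
      -- the regression problem is well posed and the interpolator is the zeroth entry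
      -- of its unique solution
      IsUnit (LocalPoly.gramMatrix K l m h x).det ∧
      (∃ Φ : LocalPoly.MultiIndex d l → ℝ,
        (∀ φ, φ ≠ Φ →
          LocalPoly.regressionLoss K l m h g x Φ < LocalPoly.regressionLoss K l m h g x φ) ∧
        LocalPoly.interpolator K l m h g x = Φ (LocalPoly.MultiIndex.zero d l)) ∧
      |LocalPoly.interpolator K l m h g x - g x| ≤ δ := by
  have hd1 : 1 ≤ d := by omega
  have hc : 0 < c := hb.trans_le hbc
  have hd' : (1 : ℝ) ≤ d := by exact_mod_cast hd1
  have hl1 : (1 : ℝ) ≤ l := by exact_mod_cast hd1.trans hdl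
  have hΛ := LocalPoly.Lam_pos hd1 hdl
  have hΛl := LocalPoly.Lam_mul_le_one hd1 hdl
  have hE : (1 : ℝ) ≤ (3 * Real.exp 1) ^ d :=
    one_le_pow₀ (by linarith [Real.add_one_le_exp (1 : ℝ)])
  have hbound := LocalPoly.bandwidth_le hδ.1 hL₂ hb hc hd1 hdl hm hh
  have hm0 : (0 : ℝ) < m := by
    refine lt_of_lt_of_le ?_ hm
    have := Real.rpow_pos_of_pos (one_div_pos.2 hδ.1) (1 / η)
    have := Real.exp_pos 1
    positivity
  have hmpos : 0 < m := by exact_mod_cast hm0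
  have hh0 : 0 < h := by rw [hh]; positivity
  have hX : 0 < 2 * b / (55 * (2 * L₂ + 1) * c) * (LocalPoly.Lam d l * (l : ℝ) / (d : ℝ)) := by
    positivity
  have hbound' : h ≤ 2 * b / (55 * (2 * L₂ + 1) * c) * (LocalPoly.Lam d l * (l : ℝ) / (d : ℝ)) :=
    hbound.trans (mul_le_of_le_one_right hX.le
      (Real.rpow_le_one hδ.1.le hδ.2.le (by positivity)))
  have hbc1 : b / c ≤ 1 := (div_le_one hc).2 hbc
  have hhalf : h < 1 / 2 := by
    have h1 : 2 * b / (55 * (2 * L₂ + 1) * c) = 2 / 55 * (b / c) * (1 / (2 * L₂ + 1)) := by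
      field_simp
    have h2 : 1 / (2 * L₂ + 1) ≤ 1 := by rw [div_le_one (by positivity)]; linarith
    have h3 : LocalPoly.Lam d l * (l : ℝ) / d ≤ 1 := (div_le_self (by positivity) hd').trans hΛl
    calc h ≤ _ := hbound'
      _ ≤ 2 / 55 * 1 * 1 * 1 := by rw [h1]; gcongr
      _ < 1 / 2 := by norm_num
  have hmh : (l : ℝ) + 2 ≤ m * h := by
    have e : (m : ℝ) * h = 4 * (l : ℝ) * (3 * Real.exp 1) ^ d / LocalPoly.Lam d l := by
      rw [hh]; field_simp
    have hΛ1 : LocalPoly.Lam d l ≤ 1 := (le_mul_of_one_le_right hΛ.le hl1).trans hΛl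
    rw [e, le_div_iff₀ hΛ]
    calc ((l : ℝ) + 2) * LocalPoly.Lam d l ≤ (l + 2) * 1 := by gcongr
      _ ≤ 4 * l * 1 := by linarith
      _ ≤ _ := by gcongr
  refine ⟨⟨hh0, hhalf⟩, hbound', fun x hx =>
    ⟨LocalPoly.isUnit_det_gramMatrix hb hK hmpos hh0 hx hmh,
    ⟨LocalPoly.regressionCoeff K l m h g x, fun φ hφ =>
      LocalPoly.regressionLoss_lt hb hK hmpos hh0 hx hmh g hφ,
      LocalPoly.interpolator_eq_regressionCoeff g⟩, ?_⟩⟩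
  have hceil : ⌈η⌉ = (l : ℤ) + 1 := by omega
  have horder : LocalPoly.holderOrder η = l := by
    have : ((⌈η⌉₊ : ℕ) : ℤ) = ⌈η⌉ := Int.natCast_ceil_eq_ceil hη.le
    unfold LocalPoly.holderOrder
    omega
  have hlη : (l : ℝ) ≤ η := by
    have := (Int.lt_ceil (a := η) (z := (l : ℤ))).1 (by omega)
    exact_mod_cast this.le
  have hx1 : x ∈ LocalPoly.cube d 0 1 := LocalPoly.mem_cube.2 fun i => by
    have := LocalPoly.mem_cube.1 hx i
    constructor <;> linarith
  obtain ⟨τ, hτ⟩ := LocalPoly.exists_taylorPoly_eq_sum l g x h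
  -- The Taylor bound at `y = x` has right-hand side `0 ^ η = 0`.
  have hτ0 : τ (LocalPoly.MultiIndex.zero d l) = g x := by
    have h1 : LocalPoly.taylorPoly l g x (h • (0 : Fin d → ℝ)) = LocalPoly.polyFun τ 0 := hτ 0
    have h2 := hg.abs_sub_taylorPoly_le hL₂.le (by rw [horder]; exact hlη) hx1 hx1
    rw [LocalPoly.polyFun_zero, smul_zero] at h1
    rw [← h1]
    simp only [sub_self, abs_zero, Finset.sum_const_zero, Real.zero_rpow hη.ne', mul_zero,
      horder] at h2
    exact (sub_eq_zero.1 (abs_nonpos_iff.1 h2)).symm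
  have hsq := LocalPoly.sq_interpolator_sub_le hb hbc hK hmpos hh0 hx hmh g τ
    (R := L₂ * (d * h) ^ η) fun y hy hyx => by
      have hy1 : y ∈ LocalPoly.cube d 0 1 := LocalPoly.mem_cube.2 fun j => by
        obtain ⟨k, hk, hky⟩ := Finset.mem_image.1 (Fintype.mem_piFinset.1 hy j)
        rw [← hky]
        refine ⟨by positivity, (div_le_one hm0).2 ?_⟩
        exact_mod_cast (Finset.mem_Icc.1 hk).2
      have h1 : y - x = h • LocalPoly.rescale h x y := by
        ext j
        simp only [LocalPoly.rescale, Pi.sub_apply, Pi.smul_apply, smul_eq_mul]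
        field_simp
      have h2 := hg.abs_sub_taylorPoly_le hL₂.le (by rw [horder]; exact hlη) hx1 hy1
      rw [horder, h1, hτ] at h2
      refine h2.trans (mul_le_mul_of_nonneg_left ?_ hL₂.le)
      refine Real.rpow_le_rpow (Finset.sum_nonneg fun _ _ => abs_nonneg _) ?_ hη.le
      calc ∑ j, |y j - x j| ≤ ∑ _j : Fin d, h := Finset.sum_le_sum fun j _ => hyx j
        _ = d * h := by simp
  rw [hτ0] at hsq
  set Y : ℝ := 2 / 55 * (LocalPoly.Lam d l * l) * (b / c) with hY
  have hY0 : 0 < Y := by positivity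
  have hY1 : Y ≤ 1 := by
    calc Y ≤ 2 / 55 * 1 * 1 := by rw [hY]; gcongr
      _ ≤ 1 := by norm_num
  have hη1 : 1 ≤ η := hl1.trans hlη
  have hdh : d * h ≤ Y * (1 / (2 * L₂ + 1)) * δ ^ (1 / η) := by
    calc d * h ≤ d * _ := mul_le_mul_of_nonneg_left hbound (by linarith)
      _ = _ := by rw [hY]; field_simp
  have hR : L₂ * (d * h) ^ η ≤ Y ^ d * δ := by
    have hq : 0 < 1 / (2 * L₂ + 1) := by positivity
    have hq1 : 1 / (2 * L₂ + 1) ≤ 1 := by rw [div_le_one (by positivity)]; linarith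
    have hδη : 0 < δ ^ (1 / η) := Real.rpow_pos_of_pos hδ.1 _
    calc L₂ * (d * h) ^ η ≤ L₂ * (Y * (1 / (2 * L₂ + 1)) * δ ^ (1 / η)) ^ η := by gcongr
      _ = L₂ * (Y ^ η * (1 / (2 * L₂ + 1)) ^ η * δ) := by
          rw [Real.mul_rpow (by positivity) hδη.le, Real.mul_rpow hY0.le hq.le,
            ← Real.rpow_mul hδ.1.le,
            one_div_mul_cancel hη.ne', Real.rpow_one]
      -- Both bases are at most 1: `η ≥ l ≥ d` lowers the exponent of `Y` to `d`, and `η ≥ 1` keeps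
      -- one factor `1 / (2L₂+1)` to absorb `L₂`.
      _ ≤ L₂ * (Y ^ d * (1 / (2 * L₂ + 1)) * δ) := by
          have h1 : Y ^ η ≤ Y ^ d := by
            rw [← Real.rpow_natCast]
            exact Real.rpow_le_rpow_of_exponent_ge hY0 hY1
              (le_trans (by exact_mod_cast hdl) hlη)
          have h2 : (1 / (2 * L₂ + 1)) ^ η ≤ 1 / (2 * L₂ + 1) :=
            Real.rpow_le_self_of_le_one hq.le hq1 hη1
          have h3 := hδ.1.le
          gcongr
      _ = L₂ * (1 / (2 * L₂ + 1)) * (Y ^ d * δ) := by ring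
      _ ≤ 1 * (Y ^ d * δ) := by
          refine mul_le_mul_of_nonneg_right ?_ (mul_nonneg (by positivity) hδ.1.le)
          rw [mul_one_div, div_le_one (by positivity)]
          linarith
      _ = _ := one_mul _
  refine abs_le_of_sq_le_sq ?_ hδ.1.le
  have hconst := LocalPoly.leastSquares_const_mul_sq_le_one hb hbc hd1 hdl
  rw [← hY] at hconst
  set C : ℝ := 2 * ((l : ℝ) + 1) ^ (2 * l + 2) * (c / b) with hC
  have hC0 : 0 ≤ C := by positivity
  clear_value C Y
  calc _ ≤ C ^ d * (L₂ * (d * h) ^ η) ^ 2 := hsq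
    _ ≤ C ^ d * (Y ^ d * δ) ^ 2 := by gcongr
    _ = (C * Y ^ 2) ^ d * δ ^ 2 := by ring
    _ ≤ 1 * δ ^ 2 := by
        gcongr
        exact pow_le_one₀ (by positivity) hconst
    _ = δ ^ 2 := one_mul _
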